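/- Let $N\ge 1$, let $S=\mathbb{C}[X_1,\dots,X_N]$ with its standard grading and with the action of $\operatorname{GL}_N(\mathbb{C})$ by linear changes of coordinates $g\cdot X_j=\sum_i g_{ij}X_i$ (so that the span of the variables is the standard representation $\mathbb{C}^N$), and let $\mathfrak{m}=(X_1,\dots,X_N)$. Let $H^j_{\mathfrak{m}}(S)=\varinjlim_d \operatorname{Ext}^j_S(S/\mathfrak{m}^d,S)$ be the local cohomology of $S$ with support in $\mathfrak{m}$, with the induced $\mathbb{Z}$-grading and $\operatorname{GL}_N(\mathbb{C})$-action. For a dominant weight $\lambda\in\mathbb{Z}^N$, $\lambda_1\ge\dots\ge\lambda_N$, let $\mathbb{S}_\lambda\mathbb{C}^N$ be the irreducible rational representation of $\operatorname{GL}_N(\mathbb{C})$ with highest weight $\lambda$. Then there is a graded $\operatorname{GL}_N(\mathbb{C})$-equivariant ($\mathbb{C}$-linear) isomorphism $$H^N_{\mathfrak{m}}(S)\;\simeq\;\bigoplus_{i\ge 0}\mathbb{S}_{(-1^{N-1},\,-i-1)}\mathbb{C}^N,$$ where $(-1^{N-1},-i-1)=(-1,\dots,-1,-i-1)$ with $N-1$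 entries equal to $-1$, and where the $i$-th summand is placed in degree $-i-N$. Moreover, $H^j_{\mathfrak{m}}(S)=0$ for all $j\ne N$. -/

import Mathlib

open CategoryTheory DirectSum

noncomputable section

namespace GLN

/-! ### The polynomial ring, its grading and the action of the general linear group -/

/-- The polynomial ring `S = ℂ[X_1, …, X_N]`. -/
abbrev Poly (N : ℕ) : Type := MvPolynomial (Fin N) ℂ

/-- The maximal homogeneous ideal `𝔪 = (X_1, …, X_N)` of `S`. -/
abbrev maxIdeal (N : ℕ) : Ideal (Poly N) := MvPolynomial.idealOfVars (Fin N) ℂ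

/-- The action of `g ∈ GL_N(ℂ)` on `S` by the linear change of coordinates
`X_j ↦ ∑ i, g i j * X_i`; the span of the variables is thus the standard representation `ℂ^N`. -/
def coordChange {N : ℕ} (g : GL (Fin N) ℂ) : Poly N →ₐ[ℂ] Poly N :=
  MvPolynomial.aeval fun j => ∑ i, MvPolynomial.C ((g : Matrix (Fin N) (Fin N) ℂ) i j) *
    MvPolynomial.X i

theorem coordChange_one {N : ℕ} (f : Poly N) : coordChange (1 : GL (Fin N) ℂ) f = f := by
  have h : coordChange (1 : GL (Fin N) ℂ) = AlgHom.id ℂ (Poly N) := by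
    ext1 j
    simp [coordChange, Matrix.one_apply]
  simp [h]

theorem coordChange_mul {N : ℕ} (g h : GL (Fin N) ℂ) (f : Poly N) :
    coordChange (g * h) f = coordChange g (coordChange h f) := by
  have H : coordChange (g * h) = (coordChange g).comp (coordChange h) := by
    ext1 j
    simp only [coordChange, AlgHom.comp_apply, MvPolynomial.aeval_X, map_sum, map_mul,
      Units.val_mul, Matrix.mul_apply, MvPolynomial.algHom_C, Finset.sum_mul, Finset.mul_sum]
    rw [Finset.sum_comm]
    refine Finset.sum_congr rfl fun k _ => Finset.sum_congr rfl fun i _ => ?_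
    simp only [MvPolynomial.algebraMap_eq]
    ring
  simp [H]

theorem coordChange_inv_apply {N : ℕ} (g : GL (Fin N) ℂ) (f : Poly N) :
    coordChange g (coordChange g⁻¹ f) = f := by
  rw [← coordChange_mul, mul_inv_cancel, coordChange_one]

theorem maxIdeal_pow_le_comap {N : ℕ} (g : GL (Fin N) ℂ) (d : ℕ) :
    maxIdeal N ^ d ≤ (maxIdeal N ^ d).comap (coordChange g).toRingHom := by
  rw [← Ideal.map_le_iff_le_comap, Ideal.map_pow]
  refine Ideal.pow_right_mono ?_ d
  rw [Ideal.map_le_iff_le_comap]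
  refine Ideal.span_le.mpr ?_
  rintro _ ⟨j, rfl⟩
  have : coordChange g (MvPolynomial.X j) ∈ maxIdeal N := by
    simp only [coordChange, MvPolynomial.aeval_X]
    exact Ideal.sum_mem _ fun i _ => Ideal.mul_mem_left _ _ (Ideal.subset_span ⟨i, rfl⟩)
  simpa using this

/-- The `k`-th graded piece of `S`, `k ∈ ℤ`, for the standard grading (zero if `k < 0`). -/
def polyPiece (N : ℕ) (k : ℤ) : AddSubgroup (Poly N) where
  carrier := {f | ∀ e, f.coeff e ≠ 0 → (e.degree : ℤ) = k}
  zero_mem' := by intro e he; simp at he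
  add_mem' := by
    intro f h hf hh e he
    by_cases h1 : f.coeff e = 0
    · exact hh e (by simpa [h1] using he)
    · exact hf e h1
  neg_mem' := by intro f hf e he; exact hf e (by simpa using he)

/-- A `ℤ`-graded module over the standard graded polynomial ring `S`. -/
structure GrMod (N : ℕ) where
  /-- the underlying `S`-module -/
  carrier : ModuleCat.{0} (Poly N)
  /-- the graded pieces -/
  piece : ℤ → AddSubgroup carrier
  isInternal : DirectSum.IsInternal piece
  smul_mem : ∀ (a : ℕ) (f : Poly N), f.IsHomogeneous a → ∀ (k : ℤ) (m : carrier),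
    m ∈ piece k → f • m ∈ piece (a + k)

theorem isInternal_of_surjective {N : ℕ} {M : Type} [AddCommGroup M] (π : Poly N →+ M)
    (hπ : Function.Surjective π)
    (hker : ∀ f, π f = 0 → ∀ n, π (MvPolynomial.homogeneousComponent n f) = 0) :
    DirectSum.IsInternal fun k => (polyPiece N k).map π := by
  classical
  constructor
  · rw [injective_iff_map_eq_zero]
    intro x hx
    have hc : ∀ k, ∃ f : Poly N, f ∈ polyPiece N k ∧ π f = x k := fun k => (x k).2
    choose f hf hfx using hc
    rw [DirectSum.coeAddMonoidHom_eq_dfinsuppSum, DFinsupp.sum] at hx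
    simp only [← hfx] at hx
    rw [← map_sum] at hx
    ext k
    rw [DirectSum.zero_apply, ZeroMemClass.coe_zero, ← hfx]
    by_cases hk : k < 0
    · have : f k = 0 := by
        ext e
        by_contra h
        have := hf k e h
        omega
      rw [this, map_zero]
    · obtain ⟨n, rfl⟩ := Int.eq_ofNat_of_zero_le (not_lt.mp hk)
      by_cases hs : (n : ℤ) ∈ x.support
      · have h1 := hker _ hx n
        have h2 : ∀ i, MvPolynomial.homogeneousComponent n (f i) =
            if i = (n : ℤ) then f i else 0 := by
          intro i
          ext e
          rw [MvPolynomial.coeff_homogeneousComponent]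
          by_cases h0 : (f i).coeff e = 0
          · split_ifs <;> simp [h0]
          · have := hf i e h0
            subst this
            by_cases hd : e.degree = n
            · simp [hd]
            · simp [hd]
        rw [map_sum, Finset.sum_congr rfl fun i _ => h2 i, Finset.sum_ite_eq', if_pos hs] at h1
        exact h1
      · rw [DFinsupp.notMem_support_iff] at hs
        rw [hfx, hs]; rfl
  · intro m
    obtain ⟨f, rfl⟩ := hπ m
    have key : ∀ n : ℕ, MvPolynomial.homogeneousComponent n f ∈ polyPiece N n := by
      intro n e he
      rw [MvPolynomial.coeff_homogeneousComponent] at he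
      by_contra h
      exact he (if_neg fun h' => h (by exact_mod_cast h'))
    refine ⟨∑ n ∈ Finset.range (f.totalDegree + 1),
      DirectSum.of (fun k => (polyPiece N k).map π) (n : ℤ)
        ⟨π (MvPolynomial.homogeneousComponent n f), ⟨_, key n, rfl⟩⟩, ?_⟩
    rw [map_sum]
    simp only [DirectSum.coeAddMonoidHom_of]
    rw [← map_sum, MvPolynomial.sum_homogeneousComponent]

theorem polyPiece_mul_mem {N : ℕ} {a : ℕ} {f : Poly N} (hf : f.IsHomogeneous a) {k : ℤ}
    {h : Poly N} (hh : h ∈ polyPiece N k) : f * h ∈ polyPiece N (a + k) := by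
  classical
  intro e he
  rw [MvPolynomial.coeff_mul] at he
  obtain ⟨⟨u, v⟩, huv, hne⟩ := Finset.exists_ne_zero_of_sum_ne_zero he
  have h1 : f.coeff u ≠ 0 := left_ne_zero_of_mul hne
  have h2 : h.coeff v ≠ 0 := right_ne_zero_of_mul hne
  have h3 := hh v h2
  have h4 : u.degree = a := by
    rw [Finsupp.degree_eq_weight_one]; exact hf h1
  have h5 : u + v = e := by simpa using huv
  rw [← h5, map_add, h4, ← h3]
  push_cast
  rfl

/-- `S` as a graded module over itself. -/
def grSelf (N : ℕ) : GrMod N where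
  carrier := ModuleCat.of (Poly N) (Poly N)
  piece k := polyPiece N k
  isInternal := by
    have := isInternal_of_surjective (AddMonoidHom.id (Poly N)) Function.surjective_id
      (by rintro f (rfl : f = 0) n; simp)
    simpa only [AddSubgroup.map_id] using this
  smul_mem _ _ hf _ _ hm := polyPiece_mul_mem hf hm

/-- `S / 𝔪 ^ d` with the grading induced from `S`. -/
def grQuot (N d : ℕ) : GrMod N where
  carrier := ModuleCat.of (Poly N) (Poly N ⧸ maxIdeal N ^ d)
  piece k := (polyPiece N k).map (Ideal.Quotient.mk (maxIdeal N ^ d)).toAddMonoidHom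
  isInternal := isInternal_of_surjective _ Ideal.Quotient.mk_surjective (by
    intro f hf n
    have hf' : f ∈ maxIdeal N ^ d := Ideal.Quotient.eq_zero_iff_mem.mp hf
    refine Ideal.Quotient.eq_zero_iff_mem.mpr ?_
    rw [MvPolynomial.mem_pow_idealOfVars_iff'] at hf' ⊢
    intro e he
    rw [MvPolynomial.coeff_homogeneousComponent, hf' e he, ite_self])
  smul_mem a f hf k := by
    rintro _ ⟨h, hh, rfl⟩
    exact ⟨f * h, polyPiece_mul_mem hf hh, map_mul (Ideal.Quotient.mk (maxIdeal N ^ d)) f h⟩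

/-! ### Local cohomology of `S` with support in `𝔪` -/

/-- The `S`-module `S / 𝔪 ^ d`. -/
abbrev quotPow (N d : ℕ) : ModuleCat.{0} (Poly N) :=
  ModuleCat.of (Poly N) (Poly N ⧸ maxIdeal N ^ d)

/-- The free `S`-module `S`. -/
abbrev polyMod (N : ℕ) : ModuleCat.{0} (Poly N) := ModuleCat.of (Poly N) (Poly N)

/-- `Ext^j_S(S / 𝔪 ^ d, S)`. -/
abbrev ExtPow (N j d : ℕ) : Type := Abelian.Ext.{0} (quotPow N d) (polyMod N) j

/-- The canonical projection `S / 𝔪 ^ d' ⟶ S / 𝔪 ^ d` for `d ≤ d'`. -/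
def quotPowProj (N : ℕ) {d d' : ℕ} (h : d ≤ d') : quotPow N d' ⟶ quotPow N d :=
  ModuleCat.ofHom (Submodule.factor (Ideal.pow_le_pow_right h))

/-- The transition map `Ext^j_S(S / 𝔪 ^ d, S) → Ext^j_S(S / 𝔪 ^ d', S)` for `d ≤ d'`. -/
def extTransition (N j : ℕ) (d d' : ℕ) (h : d ≤ d') : ExtPow N j d →ₗ[ℂ] ExtPow N j d' :=
  (Abelian.Ext.mk₀ (quotPowProj N h)).precompOfLinear ℂ (polyMod N) (zero_add j)

/-- The (complex vector space underlying the) local cohomology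
`H^j_𝔪(S) = colim_d Ext^j_S(S / 𝔪 ^ d, S)`. -/
def LocCoh (N j : ℕ) : Type := Module.DirectLimit (ExtPow N j) (extTransition N j)

instance (N j : ℕ) : AddCommGroup (LocCoh N j) :=
  inferInstanceAs (AddCommGroup (Module.DirectLimit (ExtPow N j) (extTransition N j)))

instance (N j : ℕ) : Module ℂ (LocCoh N j) :=
  inferInstanceAs (Module ℂ (Module.DirectLimit (ExtPow N j) (extTransition N j)))

/-- The canonical map `Ext^j_S(S / 𝔪 ^ d, S) → H^j_𝔪(S)`. -/
def LocCoh.of (N j d : ℕ) : ExtPow N j d →ₗ[ℂ] LocCoh N j :=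
  Module.DirectLimit.of ℂ ℕ (ExtPow N j) (extTransition N j) d

/-! ### The action of the general linear group on local cohomology

For `S`-modules `M`, `P` with compatible `GL_N(ℂ)`-actions, `g` acts on `Hom_S(M, P)` by
`φ ↦ g ∘ φ ∘ g⁻¹`.  Here `g⁻¹ : M → M` and `g : P → P` are not `S`-linear; they are `S`-linear as
maps `M ⟶ T M` and `T P ⟶ P`, where `T` is restriction of scalars along the ring homomorphism
`g⁻¹ : S → S`.  As `T` is exact, it acts on `Ext`, which gives the action of `g` on `Ext`. -/

/-- Restriction of scalars along the action of `g⁻¹` on `S`. -/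
abbrev twist {N : ℕ} (g : GL (Fin N) ℂ) : ModuleCat.{0} (Poly N) ⥤ ModuleCat.{0} (Poly N) :=
  ModuleCat.restrictScalars (coordChange g⁻¹).toRingHom

instance {N : ℕ} (g : GL (Fin N) ℂ) : (twist g).Linear ℂ where
  map_smul {M P} f c := by
    ext m
    exact congrArg (fun s : Poly N => s • f.hom m) ((coordChange g⁻¹).commutes c).symm

/-- The action of `g⁻¹` on `S / 𝔪 ^ d`, as a linear map to the twisted module. -/
def quotAct {N : ℕ} (g : GL (Fin N) ℂ) (d : ℕ) :
    quotPow N d ⟶ (twist g).obj (quotPow N d) :=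
  ModuleCat.ofHom (Y := (twist g).obj (quotPow N d))
    { toFun := Ideal.quotientMap (maxIdeal N ^ d) (coordChange g⁻¹).toRingHom
        (maxIdeal_pow_le_comap g⁻¹ d)
      map_add' := map_add _
      map_smul' := by
        intro s m
        obtain ⟨m, rfl⟩ := Ideal.Quotient.mk_surjective m
        exact congrArg (Ideal.Quotient.mk (maxIdeal N ^ d)) (map_mul (coordChange g⁻¹) s m) }

/-- The action of `g` on `S`, as a linear map from the twisted module. -/
def polyAct {N : ℕ} (g : GL (Fin N) ℂ) : (twist g).obj (polyMod N) ⟶ polyMod N :=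
  ModuleCat.ofHom (X := (twist g).obj (polyMod N))
    { toFun := coordChange g
      map_add' := map_add _
      map_smul' := by
        intro s (m : Poly N)
        change coordChange g (coordChange g⁻¹ s * m) = s * coordChange g m
        rw [map_mul, coordChange_inv_apply] }

/-- The action of `g ∈ GL_N(ℂ)` on `Ext^j_S(S / 𝔪 ^ d, S)`. -/
def extAct (N j d : ℕ) (g : GL (Fin N) ℂ) : ExtPow N j d →ₗ[ℂ] ExtPow N j d :=
  (Abelian.Ext.mk₀ (quotAct g d)).precompOfLinear ℂ (polyMod N) (zero_add j) ∘ₗ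
    (Abelian.Ext.mk₀ (polyAct g)).postcompOfLinear ℂ ((twist g).obj (quotPow N d)) (add_zero j) ∘ₗ
      (twist g).mapExtLinearMap ℂ (quotPow N d) (polyMod N) j

theorem quotAct_proj {N : ℕ} (g : GL (Fin N) ℂ) {d d' : ℕ} (h : d ≤ d') :
    quotAct g d' ≫ (twist g).map (quotPowProj N h) = quotPowProj N h ≫ quotAct g d := by
  refine ModuleCat.hom_ext (LinearMap.ext fun m => ?_)
  obtain ⟨m, rfl⟩ := Ideal.Quotient.mk_surjective m
  rfl

theorem extAct_transition (N j : ℕ) (g : GL (Fin N) ℂ) (d d' : ℕ) (h : d ≤ d') :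
    extAct N j d' g ∘ₗ extTransition N j d d' h = extTransition N j d d' h ∘ₗ extAct N j d g := by
  ext x
  simp only [extAct, extTransition, LinearMap.comp_apply, Functor.mapExtLinearMap_apply,
    Abelian.Ext.bilinearCompOfLinear_apply_apply, LinearMap.flip_apply,
    Abelian.Ext.mapExactFunctor_comp, Abelian.Ext.mapExactFunctor_mk₀]
  rw [Abelian.Ext.comp_assoc_of_third_deg_zero, Abelian.Ext.mk₀_comp_mk₀_assoc,
    Abelian.Ext.mk₀_comp_mk₀_assoc, quotAct_proj]

/-- The action of `g ∈ GL_N(ℂ)` on `H^j_𝔪(S)`. -/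
def locCohAct (N j : ℕ) (g : GL (Fin N) ℂ) : LocCoh N j →ₗ[ℂ] LocCoh N j :=
  Module.DirectLimit.map (fun d => extAct N j d g) (extAct_transition N j g)

/-! ### The grading of local cohomology -/

/-- `f` is homogeneous of degree `k`, that is, it maps degree `l` to degree `l + k`. -/
def IsHomogeneousHom {N : ℕ} (X Y : GrMod N) (f : X.carrier ⟶ Y.carrier) (k : ℤ) : Prop :=
  ∀ l, ∀ x ∈ X.piece l, f.hom x ∈ Y.piece (l + k)

/-- A class in `Ext^n_S(X, Y)`, for graded modules `X` and `Y`, is homogeneous of degree `k` if it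
is the class of a Yoneda extension of graded modules: for `n = 0`, if it is a homogeneous
homomorphism of degree `k`; for `n + 1`, if it is the image of a class of degree `k` in
`Ext^n_S(K, Y)` under the connecting map of a short exact sequence `0 ⟶ K ⟶ P ⟶ X ⟶ 0` of graded
modules with maps of degree `0`. -/
def IsHomogeneousExt {N : ℕ} (Y : GrMod N) (k : ℤ) :
    (n : ℕ) → (X : GrMod N) → Abelian.Ext.{0} X.carrier Y.carrier n → Prop
  | 0, X, x => ∃ f : X.carrier ⟶ Y.carrier, IsHomogeneousHom X Y f k ∧ x = Abelian.Ext.mk₀ f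
  | n + 1, X, x => ∃ (K P : GrMod N) (i : K.carrier ⟶ P.carrier) (p : P.carrier ⟶ X.carrier)
      (w : i ≫ p = 0) (hs : (ShortComplex.mk i p w).ShortExact)
      (y : Abelian.Ext.{0} K.carrier Y.carrier n),
      IsHomogeneousHom K P i 0 ∧ IsHomogeneousHom P X p 0 ∧ IsHomogeneousExt Y k n K y ∧
        x = hs.extClass.comp y (add_comm 1 n)

/-- The degree `k` piece of `H^j_𝔪(S)`: the span of the images of the homogeneous classes of
degree `k` in the graded modules `Ext^j_S(S / 𝔪 ^ d, S)`. -/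
def locCohPiece (N j : ℕ) (k : ℤ) : Submodule ℂ (LocCoh N j) :=
  Submodule.span ℂ
    {x | ∃ (d : ℕ) (e : ExtPow N j d), IsHomogeneousExt (grSelf N) k j (grQuot N d) e ∧
      LocCoh.of N j d e = x}

/-! ### The irreducible representations attached to dominant weights -/

/-- Dominant weights `λ ∈ ℤ^N`, `λ_1 ≥ ⋯ ≥ λ_N`. -/
abbrev DominantWeight (N : ℕ) : Type := {lam : Fin N → ℤ // Antitone lam}

/-- The leading principal minor of `x` with rows and columns `1, …, l`
(here `l : Fin N` is zero-based, so that the size is `l + 1`). -/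
def leadingMinor {N : ℕ} (l : Fin N) (x : GL (Fin N) ℂ) : ℂ :=
  ((x : Matrix (Fin N) (Fin N) ℂ).submatrix (Subtype.val : {i : Fin N // i ≤ l} → Fin N)
    Subtype.val).det

/-- The function `∏ l, det_l ^ (λ_l - λ_{l+1})` on `GL_N(ℂ)` (with `λ_{N+1} = 0`), where `det_l` is
the leading principal minor of size `l`. For the action by right translation it is a highest
weight vector of weight `λ`. The exponents are nonnegative except possibly that of `det_N`. -/
def highestWeightFn {N : ℕ} (lam : DominantWeight N) (x : GL (Fin N) ℂ) : ℂ :=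
  ∏ l : Fin N, leadingMinor l x ^
    (lam.1 l - if h : (l : ℕ) + 1 < N then lam.1 ⟨l + 1, h⟩ else 0)

/-- The representation of `GL_N(ℂ)` on functions on `GL_N(ℂ)` by right translation,
`(g f)(x) = f(x g)`. -/
def rightTranslation (N : ℕ) : Representation ℂ (GL (Fin N) ℂ) (GL (Fin N) ℂ → ℂ) where
  toFun g := LinearMap.funLeft ℂ ℂ fun x => x * g
  map_one' := by ext; simp [LinearMap.funLeft_apply]
  map_mul' g h := by ext; simp [LinearMap.funLeft_apply, mul_assoc]

/-- The irreducible representation `𝕊_λ ℂ^N` of highest weight `λ`, realised (Deruyts, Weyl) as the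
span of the right translates of the highest weight vector `∏ l, det_l ^ (λ_l - λ_{l+1})` in the
coordinate ring of `GL_N(ℂ)`. -/
def schur {N : ℕ} (lam : DominantWeight N) : Submodule ℂ (GL (Fin N) ℂ → ℂ) :=
  Submodule.span ℂ (Set.range fun g => rightTranslation N g (highestWeightFn lam))

theorem schur_le_comap {N : ℕ} (lam : DominantWeight N) (g : GL (Fin N) ℂ) :
    schur lam ≤ (schur lam).comap (rightTranslation N g) := by
  rw [schur, Submodule.span_le]
  rintro _ ⟨h, rfl⟩
  refine Submodule.subset_span ⟨g * h, ?_⟩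
  simp only [map_mul, Module.End.mul_apply]

/-- The action of `GL_N(ℂ)` on `𝕊_λ ℂ^N`. -/
def schurRep {N : ℕ} (lam : DominantWeight N) : Representation ℂ (GL (Fin N) ℂ) (schur lam) where
  toFun g := (rightTranslation N g).restrict (schur_le_comap lam g)
  map_one' := by ext1; apply Subtype.ext; simp
  map_mul' g h := by ext1; apply Subtype.ext; simp

/-- The dominant weight `(-1^{N-1}, -i-1)`. -/
def locCohWeight (N i : ℕ) : DominantWeight N :=
  ⟨fun l => if (l : ℕ) + 1 < N then -1 else -(i : ℤ) - 1, by
    intro a b hab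
    have : (a : ℕ) ≤ b := hab
    dsimp only
    split_ifs <;> omega⟩

end GLN

end

/-!
The module `S / (X_1, …, X_r)` has its extension groups into `S` concentrated in degree `r`, where
they form a cyclic module with annihilator `(X_1, …, X_r)`: the variables form a regular sequence,
and the connecting map of multiplication by `X_{r + 1}` passes from `r` to `r + 1`
(`IsExtGenerator.extClass_comp`). For `r = N` this shows that `Ext^j(S / 𝔪, S)` vanishes for
`j ≠ N` and is a line for `j = N`. The group `GL_N(ℂ)` acts on this line by a character, which is
`det⁻¹`: on diagonal matrices it is read off from the connecting maps, and transvections are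
commutators (`extAct_one`).

As `𝔪 ^ d / 𝔪 ^ (d + 1)` is a direct sum of copies of `S / 𝔪` indexed by the monomials of degree
`d`, the long exact sequences give the vanishing of `Ext^j(S / 𝔪 ^ d, S)` for `j ≠ N`, and show that
local cohomology in degree `N` is the union of the subspaces `E_d = Ext^N(S / 𝔪 ^ d, S)`.
Multiplication by polynomials of degree `d` induces a pairing that identifies `E_{d + 1} / E_d` with
the dual of the space of these polynomials, twisted by `det⁻¹` (`pairing`, `pairing_extAct`). The
scalar matrix `2` acts on this quotient by `2 ^ (-d - N)`. Since these eigenvalues are distinct, its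
eigenspaces split the filtration equivariantly (`exists_eq_add_transition`, `weightSum_injective`).

The eigenspace of eigenvalue `2 ^ (-d - N)` is mapped to functions on `GL_N(ℂ)` by the matrix
coefficients `x ↦ ⟨x h, X_N ^ d⟩`. Because the powers of linear forms span all forms of degree `d`
(`mem_span_linForm_pow`), this map is injective with image the span of the translates of
`det(x)⁻¹ ((x⁻¹)_{NN}) ^ d`, which is the highest weight function of weight `(-1, …, -1, -d - 1)`
(`weightEquiv`).

For the grading, a homogeneous class of degree `k` is an eigenvector of the scalar matrix `2` for
the eigenvalue `2 ^ k`, by naturality of connecting maps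
(`extAct_dilation_of_isHomogeneousExt`), and every class is a sum of homogeneous ones, by a graded
free resolution (`mem_closure_isHomogeneousExt`).
-/

noncomputable section

namespace GLN

/-! ### Exact functors and extension groups -/

section ExactFunctors

universe w v u

variable {C : Type u} [Category.{v} C] [Abelian C]

/-- The extension class of a short exact sequence is natural with respect to morphisms of short
exact sequences into the image of a short exact sequence under an exact functor. -/
theorem extClass_comp_mk₀_eq [HasExt.{w} C] (F : C ⥤ C) [F.Additive]
    [Limits.PreservesFiniteLimits F] [Limits.PreservesFiniteColimits F]
    {S S' : ShortComplex C} (hS : S.ShortExact) (hS' : S'.ShortExact) {α₁ : S.X₁ ⟶ F.obj S'.X₁}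
    {α₂ : S.X₂ ⟶ F.obj S'.X₂} {α₃ : S.X₃ ⟶ F.obj S'.X₃} (h₁₂ : α₁ ≫ F.map S'.f = S.f ≫ α₂)
    (h₂₃ : α₂ ≫ F.map S'.g = S.g ≫ α₃) :
    hS.extClass.comp (Abelian.Ext.mk₀ α₁) (add_zero 1) =
      (Abelian.Ext.mk₀ α₃).comp (hS'.extClass.mapExactFunctor F) (zero_add 1) := by
  rw [Abelian.Ext.mapExactFunctor_extClass]
  exact hS.extClass_naturality (hS'.map_of_exact F)
    { τ₁ := α₁, τ₂ := α₂, τ₃ := α₃, comm₁₂ := h₁₂, comm₂₃ := h₂₃ }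

theorem exists_shortExact_projective [EnoughProjectives C] (X : C) :
    ∃ S : ShortComplex C, S.ShortExact ∧ Projective S.X₂ ∧ S.X₃ = X :=
  ⟨ShortComplex.mk (Limits.kernel.ι (Projective.π X)) (Projective.π X)
      (Limits.kernel.condition _),
    { exact := ShortComplex.exact_of_f_is_kernel _ (Limits.kernelIsKernel _)
      mono_f := inferInstanceAs (Mono (Limits.kernel.ι _))
      epi_g := inferInstanceAs (Epi (Projective.π X)) },
    inferInstanceAs (Projective (Projective.over X)), rfl⟩

/-- A natural transformation of exact functors `H ⟶ F ⋙ G` intertwines their actions on extension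
groups: both sides are compatible with connecting maps, so dimension shifting along projective
covers reduces the identity to the case `n = 0`. -/
theorem mapExactFunctor_natTrans [HasExt.{w} C] [EnoughProjectives C] (F G H : C ⥤ C)
    [F.Additive] [Limits.PreservesFiniteLimits F] [Limits.PreservesFiniteColimits F]
    [G.Additive] [Limits.PreservesFiniteLimits G] [Limits.PreservesFiniteColimits G]
    [H.Additive] [Limits.PreservesFiniteLimits H] [Limits.PreservesFiniteColimits H]
    (τ : H ⟶ F ⋙ G) (n : ℕ) {X Y : C} (e : Abelian.Ext.{w} X Y n) :
    (e.mapExactFunctor H).comp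
        (Abelian.Ext.mk₀ (Y := G.obj (F.obj Y)) (τ.app Y)) (add_zero n) =
      (Abelian.Ext.mk₀ (Y := G.obj (F.obj X)) (τ.app X)).comp
        ((e.mapExactFunctor F).mapExactFunctor G) (zero_add n) := by
  induction n generalizing X with
  | zero =>
    obtain ⟨f, rfl⟩ := (Abelian.Ext.mk₀_bijective _ _).2 e
    simp only [Abelian.Ext.mapExactFunctor_mk₀, Abelian.Ext.mk₀_comp_mk₀]
    exact congrArg _ (τ.naturality f)
  | succ n ih =>
    obtain ⟨S, hS, _, rfl⟩ := exists_shortExact_projective X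
    obtain ⟨y, rfl⟩ := Abelian.Ext.contravariant_sequence_exact₃ hS Y e
      (Abelian.Ext.eq_zero_of_projective _) (add_comm 1 n)
    have key : (hS.extClass.mapExactFunctor H).comp
          (Abelian.Ext.mk₀ (Y := G.obj (F.obj S.X₁)) (τ.app S.X₁)) (add_zero 1) =
        (Abelian.Ext.mk₀ (Y := G.obj (F.obj S.X₃)) (τ.app S.X₃)).comp
          ((hS.extClass.mapExactFunctor F).mapExactFunctor G) (zero_add 1) := by
      rw [Abelian.Ext.mapExactFunctor_extClass, Abelian.Ext.mapExactFunctor_extClass]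
      exact extClass_comp_mk₀_eq G (hS.map_of_exact H) (hS.map_of_exact F)
        (τ.naturality S.f).symm (τ.naturality S.g).symm
    simp only [Abelian.Ext.mapExactFunctor_comp]
    rw [Abelian.Ext.comp_assoc_of_third_deg_zero, ih,
      ← Abelian.Ext.comp_assoc (a₁₂ := 1) _ _ _ (by lia) (by lia) (by lia), key,
      Abelian.Ext.comp_assoc (a₂₃ := n + 1) _ _ _ (by lia) (by lia) (by lia)]

end ExactFunctors

/-! ### Twisted actions on extension groups -/

/-- The action of `g` on `Ext^n_S(X, S)` induced by a morphism `α : X ⟶ twist g X`, which plays the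
role of the action of `g⁻¹` on the module `X`. -/
def twistAct {N : ℕ} (g : GL (Fin N) ℂ) {X : ModuleCat.{0} (Poly N)} (α : X ⟶ (twist g).obj X)
    (n : ℕ) : Abelian.Ext.{0} X (polyMod N) n →ₗ[ℂ] Abelian.Ext.{0} X (polyMod N) n :=
  (Abelian.Ext.mk₀ α).precompOfLinear ℂ (polyMod N) (zero_add n) ∘ₗ
    (Abelian.Ext.mk₀ (polyAct g)).postcompOfLinear ℂ ((twist g).obj X) (add_zero n) ∘ₗ
      (twist g).mapExtLinearMap ℂ X (polyMod N) n

theorem extAct_eq_twistAct (N j d : ℕ) (g : GL (Fin N) ℂ) :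
    extAct N j d g = twistAct g (quotAct g d) j := rfl

theorem twistAct_apply {N : ℕ} (g : GL (Fin N) ℂ) {X : ModuleCat.{0} (Poly N)}
    (α : X ⟶ (twist g).obj X) (n : ℕ) (e : Abelian.Ext.{0} X (polyMod N) n) :
    twistAct g α n e = (Abelian.Ext.mk₀ α).comp
      ((e.mapExactFunctor (twist g)).comp (Abelian.Ext.mk₀ (polyAct g)) (add_zero n))
      (zero_add n) := rfl

/-- Naturality of the twisted action. The maps `f` and `f'` may differ: `f'` plays the role of the
translate of `f` by `g⁻¹`. -/
theorem twistAct_precomp {N : ℕ} (g : GL (Fin N) ℂ) {X X' : ModuleCat.{0} (Poly N)}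
    {α : X ⟶ (twist g).obj X} {α' : X' ⟶ (twist g).obj X'} {f f' : X ⟶ X'}
    (h : α ≫ (twist g).map f' = f ≫ α') (n : ℕ) (e : Abelian.Ext.{0} X' (polyMod N) n) :
    twistAct g α n ((Abelian.Ext.mk₀ f').comp e (zero_add n)) =
      (Abelian.Ext.mk₀ f).comp (twistAct g α' n e) (zero_add n) := by
  rw [twistAct_apply, twistAct_apply, Abelian.Ext.mapExactFunctor_comp,
    Abelian.Ext.mapExactFunctor_mk₀, Abelian.Ext.comp_assoc_of_third_deg_zero,
    Abelian.Ext.mk₀_comp_mk₀_assoc, Abelian.Ext.mk₀_comp_mk₀_assoc, h]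

theorem twistAct_extClass {N : ℕ} (g : GL (Fin N) ℂ) {S : ShortComplex (ModuleCat.{0} (Poly N))}
    (hS : S.ShortExact) {α₁ : S.X₁ ⟶ (twist g).obj S.X₁} {α₂ : S.X₂ ⟶ (twist g).obj S.X₂}
    {α₃ : S.X₃ ⟶ (twist g).obj S.X₃} (h₁₂ : α₁ ≫ (twist g).map S.f = S.f ≫ α₂)
    (h₂₃ : α₂ ≫ (twist g).map S.g = S.g ≫ α₃) {n n' : ℕ} (h : 1 + n = n')
    (y : Abelian.Ext.{0} S.X₁ (polyMod N) n) :
    twistAct g α₃ n' (hS.extClass.comp y h) = hS.extClass.comp (twistAct g α₁ n y) h := by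
  rw [twistAct_apply, twistAct_apply, Abelian.Ext.mapExactFunctor_comp,
    Abelian.Ext.comp_assoc_of_third_deg_zero,
    ← Abelian.Ext.comp_assoc (a₁₂ := 1) _ _ _ (by lia) (by lia) (by lia),
    ← extClass_comp_mk₀_eq (twist g) hS hS h₁₂ h₂₃,
    Abelian.Ext.comp_assoc (a₂₃ := n) _ _ _ (by lia) (by lia) (by lia)]

theorem twistAct_smul {N : ℕ} (g : GL (Fin N) ℂ) {X : ModuleCat.{0} (Poly N)} (c : ℂ)
    (α : X ⟶ (twist g).obj X) (n : ℕ) : twistAct g (c • α) n = c • twistAct g α n := by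
  ext e
  rw [LinearMap.smul_apply, twistAct_apply, twistAct_apply, Abelian.Ext.mk₀_smul,
    Abelian.Ext.smul_comp]

theorem twistAct_mk₀ {N : ℕ} (g : GL (Fin N) ℂ) {X : ModuleCat.{0} (Poly N)}
    (α : X ⟶ (twist g).obj X) (f : X ⟶ polyMod N) :
    twistAct g α 0 (Abelian.Ext.mk₀ f) =
      Abelian.Ext.mk₀ (α ≫ (twist g).map f ≫ polyAct g) := by
  rw [twistAct_apply, Abelian.Ext.mapExactFunctor_mk₀, Abelian.Ext.mk₀_comp_mk₀,
    Abelian.Ext.mk₀_comp_mk₀]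

/-- The comparison, by the identity maps, of the twist by a product with the composite of the
twists. -/
def twistMul {N : ℕ} (g h : GL (Fin N) ℂ) : twist (g * h) ⟶ twist h ⋙ twist g :=
  (ModuleCat.restrictScalarsComp' (coordChange g⁻¹).toRingHom (coordChange h⁻¹).toRingHom
    (coordChange (g * h)⁻¹).toRingHom (by
      refine RingHom.ext fun s => ?_
      change coordChange (g * h)⁻¹ s = coordChange h⁻¹ (coordChange g⁻¹ s)
      rw [mul_inv_rev, coordChange_mul])).hom

/-- The component of `twistMul g h` at `X`. -/
def twistMulApp {N : ℕ} (g h : GL (Fin N) ℂ) (X : ModuleCat.{0} (Poly N)) :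
    (twist (g * h)).obj X ⟶ (twist g).obj ((twist h).obj X) :=
  (twistMul g h).app X

theorem polyAct_mul {N : ℕ} (g h : GL (Fin N) ℂ) :
    polyAct (g * h) = twistMulApp g h (polyMod N) ≫ (twist g).map (polyAct h) ≫ polyAct g := by
  refine ModuleCat.hom_ext (LinearMap.ext fun m => ?_)
  exact coordChange_mul g h m

/-- The twisted actions of `g` and `h` compose to that of `g * h`, because the twist by `g * h` is the
composite of the two twists. -/
theorem twistAct_mul {N : ℕ} (g h : GL (Fin N) ℂ) {X : ModuleCat.{0} (Poly N)}
    (α : X ⟶ (twist g).obj X) (β : X ⟶ (twist h).obj X)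
    (γ : X ⟶ (twist (g * h)).obj X) (hγ : γ ≫ twistMulApp g h X = α ≫ (twist g).map β)
    (n : ℕ) (e : Abelian.Ext.{0} X (polyMod N) n) :
    twistAct (g * h) γ n e = twistAct g α n (twistAct h β n e) := by
  have hn : (e.mapExactFunctor (twist (g * h))).comp
      (Abelian.Ext.mk₀ (twistMulApp g h (polyMod N))) (add_zero n) =
        (Abelian.Ext.mk₀ (twistMulApp g h X)).comp
          ((e.mapExactFunctor (twist h)).mapExactFunctor (twist g)) (zero_add n) :=
    mapExactFunctor_natTrans (twist h) (twist g) (twist (g * h)) (twistMul g h) n e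
  have h1 : twistAct (g * h) γ n e = (Abelian.Ext.mk₀ γ).comp
      (((e.mapExactFunctor (twist (g * h))).comp
        (Abelian.Ext.mk₀ (twistMulApp g h (polyMod N))) (add_zero n)).comp
        (Abelian.Ext.mk₀ ((twist g).map (polyAct h) ≫ polyAct g)) (add_zero n)) (zero_add n) := by
    rw [twistAct_apply, polyAct_mul, Abelian.Ext.comp_assoc_of_third_deg_zero,
      Abelian.Ext.mk₀_comp_mk₀]
  have hγ' : (Abelian.Ext.mk₀ γ).comp (Abelian.Ext.mk₀ (twistMulApp g h X)) (zero_add 0) =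
      (Abelian.Ext.mk₀ α).comp (Abelian.Ext.mk₀ ((twist g).map β)) (zero_add 0) := by
    rw [Abelian.Ext.mk₀_comp_mk₀, Abelian.Ext.mk₀_comp_mk₀]
    exact congrArg _ hγ
  rw [h1, hn]
  simp only [twistAct_apply, Abelian.Ext.mapExactFunctor_comp, Abelian.Ext.mapExactFunctor_mk₀,
    ← Abelian.Ext.mk₀_comp_mk₀]
  simp only [Abelian.Ext.comp_assoc_of_third_deg_zero]
  rw [← Abelian.Ext.comp_assoc (a₁₂ := 0) _ _ _ (by lia) (by lia) (by lia), hγ',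
    Abelian.Ext.comp_assoc (a₂₃ := n) _ _ _ (by lia) (by lia) (by lia)]

theorem extAct_mul (N j d : ℕ) (g h : GL (Fin N) ℂ) (e : ExtPow N j d) :
    extAct N j d (g * h) e = extAct N j d g (extAct N j d h e) := by
  refine twistAct_mul g h _ _ _ ?_ j e
  refine ModuleCat.hom_ext (LinearMap.ext fun m => ?_)
  obtain ⟨m, rfl⟩ := Ideal.Quotient.mk_surjective m
  change Ideal.Quotient.mk (maxIdeal N ^ d) (coordChange (g * h)⁻¹ m) =
    Ideal.Quotient.mk (maxIdeal N ^ d) (coordChange h⁻¹ (coordChange g⁻¹ m))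
  rw [mul_inv_rev, coordChange_mul]

/-! ### Extension groups of quotients by regular sequences -/

/-- The quotient `S / I` as an object of the category of `S`-modules. -/
abbrev quotMod {N : ℕ} (I : Ideal (Poly N)) : ModuleCat.{0} (Poly N) :=
  ModuleCat.of (Poly N) (Poly N ⧸ I)

/-- The action of `g⁻¹` on `S / I`, for an ideal `I` stable under `g⁻¹`. -/
def quotIdealAct {N : ℕ} (g : GL (Fin N) ℂ) (I : Ideal (Poly N))
    (h : I ≤ I.comap (coordChange g⁻¹).toRingHom) : quotMod I ⟶ (twist g).obj (quotMod I) :=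
  ModuleCat.ofHom (Y := (twist g).obj (quotMod I))
    { toFun := Ideal.quotientMap I (coordChange g⁻¹).toRingHom h
      map_add' := map_add _
      map_smul' := by
        intro s m
        obtain ⟨m, rfl⟩ := Ideal.Quotient.mk_surjective m
        exact congrArg (Ideal.Quotient.mk I) (map_mul (coordChange g⁻¹) s m) }

/-- `Ext^j_S(S / I, S)` vanishes for `j ≠ r`, and the `S`-module `Ext^r_S(S / I, S)` is cyclic,
generated by `e`, with annihilator `I`. -/
structure IsExtGenerator {N : ℕ} (I : Ideal (Poly N)) (r : ℕ)
    (e : Abelian.Ext.{0} (quotMod I) (polyMod N) r) : Prop where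
  eq_zero : ∀ j, j ≠ r → ∀ z : Abelian.Ext.{0} (quotMod I) (polyMod N) j, z = 0
  exists_smul : ∀ z : Abelian.Ext.{0} (quotMod I) (polyMod N) r, ∃ s : Poly N, z = s • e
  smul_eq_zero_iff : ∀ s : Poly N, s • e = 0 ↔ s ∈ I

/-- The short complex `S / I → S / I → S / J` whose first map is the multiplication by `x`. -/
abbrev mulComplex {N : ℕ} {I J : Ideal (Poly N)} {x : Poly N} (hJ : J = I ⊔ Ideal.span {x}) :
    ShortComplex (ModuleCat.{0} (Poly N)) :=
  ShortComplex.mk (X₁ := quotMod I) (X₂ := quotMod I) (X₃ := quotMod J) (x • 𝟙 (quotMod I))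
    (ModuleCat.ofHom (Submodule.factor (hJ ▸ le_sup_left))) (by
      refine ModuleCat.hom_ext (LinearMap.ext fun m => ?_)
      obtain ⟨m, rfl⟩ := Ideal.Quotient.mk_surjective m
      refine Ideal.Quotient.eq_zero_iff_mem.mpr (?_ : x * m ∈ J)
      rw [hJ]
      exact Ideal.mul_mem_right _ _
        (Submodule.mem_sup_right (Ideal.mem_span_singleton_self x)))

theorem mulComplex_shortExact {N : ℕ} {I J : Ideal (Poly N)} {x : Poly N}
    (hJ : J = I ⊔ Ideal.span {x}) (hx : ∀ a, x * a ∈ I → a ∈ I) :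
    (mulComplex hJ).ShortExact := by
  refine ModuleCat.shortComplex_shortExact _ ?_ ?_ ?_
  · intro m
    refine ⟨fun hm => ?_, ?_⟩
    · obtain ⟨m, rfl⟩ := Ideal.Quotient.mk_surjective m
      have hm' : m ∈ J := Ideal.Quotient.eq_zero_iff_mem.mp hm
      rw [hJ] at hm'
      obtain ⟨y, hy, z, hz, rfl⟩ := Submodule.mem_sup.mp hm'
      obtain ⟨a, rfl⟩ := Ideal.mem_span_singleton'.mp hz
      refine ⟨Ideal.Quotient.mk I a, ?_⟩
      refine Ideal.Quotient.eq.mpr (?_ : x * a - (y + a * x) ∈ I)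
      have : x * a - (y + a * x) = -y := by ring
      rw [this]
      exact neg_mem hy
    · rintro ⟨m, rfl⟩
      exact congrArg (fun f : quotMod I ⟶ quotMod J => f.hom m) (mulComplex hJ).zero
  · refine (injective_iff_map_eq_zero (mulComplex hJ).f.hom).mpr fun m hm => ?_
    obtain ⟨m, rfl⟩ := Ideal.Quotient.mk_surjective m
    exact Ideal.Quotient.eq_zero_iff_mem.mpr (hx m (Ideal.Quotient.eq_zero_iff_mem.mp hm))
  · intro m
    obtain ⟨m, rfl⟩ := Ideal.Quotient.mk_surjective m
    exact ⟨Ideal.Quotient.mk I m, rfl⟩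

theorem mk₀_smul_id_comp {N n : ℕ} {X : ModuleCat.{0} (Poly N)} (s : Poly N)
    (e : Abelian.Ext.{0} X (polyMod N) n) :
    (Abelian.Ext.mk₀ (s • 𝟙 X)).comp e (zero_add n) = s • e := by
  rw [Abelian.Ext.mk₀_smul, Abelian.Ext.smul_comp, Abelian.Ext.mk₀_id_comp]

/-- If `x` is a nonzerodivisor on `S / I`, the connecting map of multiplication by `x` carries a
generator of `Ext^r_S(S / I, S)` to a generator of `Ext^{r+1}_S(S / (I + (x)), S)`. -/
theorem IsExtGenerator.extClass_comp {N : ℕ} {I J : Ideal (Poly N)} {x : Poly N}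
    (hJ : J = I ⊔ Ideal.span {x}) (hx : ∀ a, x * a ∈ I → a ∈ I) {r : ℕ}
    {e : Abelian.Ext.{0} (quotMod I) (polyMod N) r} (he : IsExtGenerator I r e) :
    IsExtGenerator J (r + 1)
      ((mulComplex_shortExact hJ hx).extClass.comp e (add_comm 1 r)) := by
  have hS := mulComplex_shortExact hJ hx
  -- Multiplication by `x` is injective on `Ext^j(S / I, S)`, so the pullback from `S / J` vanishes.
  have hp : ∀ j, ∀ z : Abelian.Ext.{0} (quotMod J) (polyMod N) j,
      (Abelian.Ext.mk₀ (mulComplex hJ).g).comp z (zero_add j) = 0 := by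
    intro j z
    by_cases hj : j = r
    · subst hj
      obtain ⟨s, hs⟩ := he.exists_smul ((Abelian.Ext.mk₀ (mulComplex hJ).g).comp z (zero_add j))
      have h1 : x • s • e = 0 := by
        rw [← hs, ← mk₀_smul_id_comp]
        change (Abelian.Ext.mk₀ (mulComplex hJ).f).comp _ _ = 0
        rw [Abelian.Ext.mk₀_comp_mk₀_assoc, (mulComplex hJ).zero, Abelian.Ext.mk₀_zero,
          Abelian.Ext.zero_comp]
      rw [smul_smul, he.smul_eq_zero_iff] at h1
      rw [hs, he.smul_eq_zero_iff]
      exact hx s h1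
    · exact he.eq_zero j hj _
  refine ⟨?_, ?_, ?_⟩
  · rintro (_ | j) hj z
    · have := hS.epi_g
      refine (injective_iff_map_eq_zero _).mp
        (Abelian.Ext.precomp_mk₀_injective_of_epi (polyMod N) (mulComplex hJ).g) z (hp 0 z)
    · obtain ⟨y, rfl⟩ := Abelian.Ext.contravariant_sequence_exact₃ hS _ z (hp _ z) (add_comm 1 j)
      rw [he.eq_zero j (by lia) y, Abelian.Ext.comp_zero]
  · intro z
    obtain ⟨y, rfl⟩ := Abelian.Ext.contravariant_sequence_exact₃ hS _ z (hp _ z) (add_comm 1 r)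
    obtain ⟨s, rfl⟩ := he.exists_smul y
    exact ⟨s, Abelian.Ext.comp_smul _ _ _ _⟩
  · intro s
    rw [← Abelian.Ext.comp_smul]
    have key : ∀ a : Poly N, s - x * a ∈ I ↔ s • e = x • a • e := by
      intro a
      rw [← he.smul_eq_zero_iff, sub_smul, sub_eq_zero, mul_smul]
    constructor
    · intro h
      obtain ⟨y, hy⟩ := Abelian.Ext.contravariant_sequence_exact₁ hS _ _ _ h
      obtain ⟨a, rfl⟩ := he.exists_smul y
      have h2 := (key a).mpr (hy.symm.trans (mk₀_smul_id_comp x _))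
      rw [hJ]
      refine Submodule.mem_sup.mpr ⟨_, h2, x * a, ?_, by ring⟩
      exact Ideal.mul_mem_right _ _ (Ideal.mem_span_singleton_self x)
    · intro h
      rw [hJ] at h
      obtain ⟨y, hy, z, hz, rfl⟩ := Submodule.mem_sup.mp h
      obtain ⟨a, rfl⟩ := Ideal.mem_span_singleton'.mp hz
      have h2 : (y + a * x) • e = x • a • e := (key a).mp (by convert hy using 1; ring)
      rw [h2, ← mk₀_smul_id_comp x]
      exact hS.extClass_comp_assoc _

theorem isExtGenerator_bot (N : ℕ) :
    ∃ e : Abelian.Ext.{0} (quotMod (⊥ : Ideal (Poly N))) (polyMod N) 0,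
      IsExtGenerator ⊥ 0 e ∧ ∀ (g : GL (Fin N) ℂ) (h), twistAct g (quotIdealAct g ⊥ h) 0 e = e := by
  let u : (Poly N ⧸ (⊥ : Ideal (Poly N))) ≃ₗ[Poly N] Poly N := Submodule.quotEquivOfEqBot ⊥ rfl
  have hu : ∀ m : Poly N, u (Ideal.Quotient.mk ⊥ m) = m := fun m => rfl
  have : Projective (quotMod (⊥ : Ideal (Poly N))) :=
    Projective.of_iso (LinearEquiv.toModuleIso u).symm
      (ModuleCat.projective_of_free (Module.Basis.singleton Unit (Poly N)))
  refine ⟨Abelian.Ext.mk₀ (ModuleCat.ofHom u.toLinearMap), ⟨?_, ?_, ?_⟩, ?_⟩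
  · rintro (_ | j) hj z
    · exact absurd rfl hj
    · exact Abelian.Ext.eq_zero_of_projective z
  · intro z
    obtain ⟨f, rfl⟩ := (Abelian.Ext.mk₀_bijective _ _).2 z
    refine ⟨f.hom (Ideal.Quotient.mk ⊥ 1), ?_⟩
    rw [← Abelian.Ext.mk₀_smul]
    refine congrArg _ (ModuleCat.hom_ext (LinearMap.ext fun m => ?_))
    obtain ⟨m, rfl⟩ := Ideal.Quotient.mk_surjective m
    have h1 : Ideal.Quotient.mk (⊥ : Ideal (Poly N)) m = m • Ideal.Quotient.mk ⊥ 1 :=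
      congrArg (Ideal.Quotient.mk ⊥) (mul_one m).symm
    rw [h1, map_smul]
    change m * f.hom _ = f.hom _ * (m * 1)
    ring
  · intro s
    rw [← Abelian.Ext.mk₀_smul, Abelian.Ext.mk₀_eq_zero_iff, Ideal.mem_bot]
    constructor
    · intro h
      have h1 := congrArg (fun f : quotMod (⊥ : Ideal (Poly N)) ⟶ polyMod N =>
        f.hom (Ideal.Quotient.mk ⊥ 1)) h
      change s * 1 = 0 at h1
      simpa using h1
    · rintro rfl
      exact zero_smul _ _
  · intro g h
    rw [twistAct_mk₀]
    refine congrArg _ (ModuleCat.hom_ext (LinearMap.ext fun m => ?_))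
    obtain ⟨m, rfl⟩ := Ideal.Quotient.mk_surjective m
    exact coordChange_inv_apply g m

/-- If `g⁻¹` multiplies `x` by the scalar `c`, then so it does with the connecting map of the
multiplication by `x`. -/
theorem twistAct_extClass_mulComplex {N : ℕ} {I J : Ideal (Poly N)} {x : Poly N}
    (hJ : J = I ⊔ Ideal.span {x}) (hx : ∀ a, x * a ∈ I → a ∈ I) {r : ℕ}
    (e : Abelian.Ext.{0} (quotMod I) (polyMod N) r) (g : GL (Fin N) ℂ) (hgI) (hgJ) (c : ℂ)
    (hc : coordChange g⁻¹ x = MvPolynomial.C c * x) :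
    twistAct g (quotIdealAct g J hgJ) (r + 1)
        ((mulComplex_shortExact hJ hx).extClass.comp e (add_comm 1 r)) =
      c • (mulComplex_shortExact hJ hx).extClass.comp
        (twistAct g (quotIdealAct g I hgI) r e) (add_comm 1 r) := by
  rw [twistAct_extClass g (mulComplex_shortExact hJ hx) (α₁ := c • quotIdealAct g I hgI)
    (α₂ := quotIdealAct g I hgI), twistAct_smul, LinearMap.smul_apply, Abelian.Ext.comp_smul]
  · refine ModuleCat.hom_ext (LinearMap.ext fun m => ?_)
    obtain ⟨m, rfl⟩ := Ideal.Quotient.mk_surjective m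
    refine congrArg (Ideal.Quotient.mk I)
      (?_ : x * (coordChange g⁻¹ (MvPolynomial.C c) * coordChange g⁻¹ m) =
        coordChange g⁻¹ (x * m))
    rw [map_mul, hc, MvPolynomial.algHom_C, MvPolynomial.algebraMap_eq]
    ring
  · refine ModuleCat.hom_ext (LinearMap.ext fun m => ?_)
    obtain ⟨m, rfl⟩ := Ideal.Quotient.mk_surjective m
    rfl

/-- The ideal generated by the first `r` variables. -/
def coordIdeal (N r : ℕ) : Ideal (Poly N) :=
  Ideal.span (MvPolynomial.X '' {i : Fin N | (i : ℕ) < r})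

theorem coordIdeal_zero (N : ℕ) : coordIdeal N 0 = ⊥ := by
  simp [coordIdeal]

theorem coordIdeal_self (N : ℕ) : coordIdeal N N = maxIdeal N := by
  simp [coordIdeal]

theorem coordIdeal_succ {N : ℕ} (r : Fin N) :
    coordIdeal N (r + 1) = coordIdeal N r ⊔ Ideal.span {MvPolynomial.X r} := by
  rw [coordIdeal, coordIdeal, ← Ideal.span_union, ← Set.image_singleton, ← Set.image_union]
  congr 2
  ext i
  simp only [Set.mem_ofPred_eq, Set.mem_union, Set.mem_singleton_iff, Fin.ext_iff]
  lia

theorem mem_coordIdeal_of_X_mul_mem {N : ℕ} (r : Fin N) (a : Poly N)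
    (h : MvPolynomial.X r * a ∈ coordIdeal N r) : a ∈ coordIdeal N r := by
  rw [coordIdeal, MvPolynomial.mem_ideal_span_X_image] at h ⊢
  intro m hm
  obtain ⟨i, hi, hne⟩ := h (Finsupp.single r 1 + m) (by
    rw [MvPolynomial.mem_support_iff, MvPolynomial.coeff_X_mul]
    exact MvPolynomial.mem_support_iff.mp hm)
  refine ⟨i, hi, ?_⟩
  have : r ≠ i := fun h => absurd hi (by simp [h])
  simpa [Finsupp.single_apply, this] using hne

theorem coordChange_inv_X_of_diagonal {N : ℕ} {g : GL (Fin N) ℂ} {t : Fin N → ℂ}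
    (hg : (g : Matrix (Fin N) (Fin N) ℂ) = Matrix.diagonal t) (j : Fin N) :
    coordChange g⁻¹ (MvPolynomial.X j) = MvPolynomial.C (t j)⁻¹ * MvPolynomial.X j := by
  have h1 : coordChange g (MvPolynomial.X j) = MvPolynomial.C (t j) * MvPolynomial.X j := by
    simp [coordChange, hg, Matrix.diagonal_apply, apply_ite, ite_mul]
  have ht : t j ≠ 0 := by
    have := (Matrix.isUnit_iff_isUnit_det _).mp g.isUnit
    rw [hg, Matrix.det_diagonal, isUnit_iff_ne_zero, Finset.prod_ne_zero_iff] at this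
    exact this j (Finset.mem_univ j)
  have h2 := congrArg (coordChange g⁻¹) h1
  rw [← coordChange_mul, inv_mul_cancel, coordChange_one, map_mul, MvPolynomial.algHom_C,
    MvPolynomial.algebraMap_eq] at h2
  calc coordChange g⁻¹ (MvPolynomial.X j)
      = MvPolynomial.C ((t j)⁻¹ * t j) * coordChange g⁻¹ (MvPolynomial.X j) := by
        rw [inv_mul_cancel₀ ht, map_one, one_mul]
    _ = _ := by rw [map_mul, mul_assoc, ← h2]

theorem coordIdeal_le_comap {N : ℕ} {g : GL (Fin N) ℂ} {t : Fin N → ℂ}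
    (hg : (g : Matrix (Fin N) (Fin N) ℂ) = Matrix.diagonal t) (r : ℕ) :
    coordIdeal N r ≤ (coordIdeal N r).comap (coordChange g⁻¹).toRingHom := by
  refine Ideal.span_le.mpr ?_
  rintro _ ⟨j, hj, rfl⟩
  change coordChange g⁻¹ (MvPolynomial.X j) ∈ coordIdeal N r
  rw [coordChange_inv_X_of_diagonal hg]
  exact Ideal.mul_mem_left _ _ (Ideal.subset_span ⟨j, hj, rfl⟩)

/-- The generator of `Ext^r_S(S / (X_1, …, X_r), S)` obtained by iterated connecting maps is
multiplied by `(t_1 ⋯ t_r)⁻¹` under the diagonal matrix with entries `t`. -/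
theorem exists_isExtGenerator_coordIdeal (N r : ℕ) (hr : r ≤ N) :
    ∃ e : Abelian.Ext.{0} (quotMod (coordIdeal N r)) (polyMod N) r,
      IsExtGenerator (coordIdeal N r) r e ∧
      ∀ (g : GL (Fin N) ℂ) (t : Fin N → ℂ)
        (_ : (g : Matrix (Fin N) (Fin N) ℂ) = Matrix.diagonal t) (h),
        twistAct g (quotIdealAct g (coordIdeal N r) h) r e =
          (∏ i with (i : Fin N).val < r, (t i)⁻¹) • e := by
  induction r with
  | zero =>
    rw [coordIdeal_zero]
    obtain ⟨e, he, h⟩ := isExtGenerator_bot N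
    exact ⟨e, he, fun g t _ h' => by simp [h g h']⟩
  | succ r ih =>
    obtain ⟨e, he, hact⟩ := ih (by lia)
    have hJ := coordIdeal_succ (⟨r, hr⟩ : Fin N)
    have hx := mem_coordIdeal_of_X_mul_mem (⟨r, hr⟩ : Fin N)
    refine ⟨_, he.extClass_comp hJ hx, fun g t hg h => ?_⟩
    rw [twistAct_extClass_mulComplex hJ hx e g (coordIdeal_le_comap hg r) h _
      (coordChange_inv_X_of_diagonal hg _), hact g t hg, Abelian.Ext.comp_smul, smul_smul]
    congr 1
    have : Finset.univ.filter (fun i : Fin N => i.val < r + 1) =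
        insert ⟨r, hr⟩ (Finset.univ.filter fun i : Fin N => i.val < r) := by
      ext i
      simp only [Finset.mem_filter, Finset.mem_univ, true_and, Finset.mem_insert, Fin.ext_iff]
      lia
    rw [this, Finset.prod_insert (by simp)]

theorem exists_isExtGenerator_maxIdeal (N : ℕ) :
    ∃ e : ExtPow N N 1, IsExtGenerator (maxIdeal N ^ 1) N e ∧
      ∀ (g : GL (Fin N) ℂ) (t : Fin N → ℂ)
        (_ : (g : Matrix (Fin N) (Fin N) ℂ) = Matrix.diagonal t),
        extAct N N 1 g e = (∏ i, (t i)⁻¹) • e := by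
  have h := exists_isExtGenerator_coordIdeal N N le_rfl
  rw [coordIdeal_self, ← pow_one (maxIdeal N)] at h
  obtain ⟨e, he, hact⟩ := h
  refine ⟨e, he, fun g t hg => ?_⟩
  have := hact g t hg (maxIdeal_pow_le_comap g⁻¹ 1)
  simp only [Fin.is_lt, Finset.filter_true] at this
  exact this

/-! ### The top extension group of the residue field -/

/-- A multiplicative function on `GL_N(ℂ)` is determined by its values on diagonal matrices, as it
is trivial on transvections: these are commutators with diagonal matrices. -/
theorem eq_det_inv_of_diagonal {N : ℕ} (χ : GL (Fin N) ℂ → ℂ)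
    (hmul : ∀ g h, χ (g * h) = χ g * χ h)
    (hdiag : ∀ (g : GL (Fin N) ℂ) (t : Fin N → ℂ),
      (g : Matrix (Fin N) (Fin N) ℂ) = Matrix.diagonal t → χ g = ∏ i, (t i)⁻¹)
    (g : GL (Fin N) ℂ) : χ g = (g : Matrix (Fin N) (Fin N) ℂ).det⁻¹ := by
  have hone : χ 1 = 1 := by
    rw [hdiag 1 1 (by ext i j; simp [Matrix.one_apply, Matrix.diagonal_apply])]
    simp
  have hne : ∀ g, χ g ≠ 0 := fun g h0 => by
    have := hmul g g⁻¹
    rw [mul_inv_cancel, hone, h0, zero_mul] at this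
    exact one_ne_zero this
  let P : Matrix (Fin N) (Fin N) ℂ → Prop := fun M =>
    ∀ g : GL (Fin N) ℂ, (g : Matrix (Fin N) (Fin N) ℂ) = M → χ g = M.det⁻¹
  refine Matrix.diagonal_transvection_induction_of_det_ne_zero P _ ?_ ?_ ?_ ?_ g rfl
  · exact ((Matrix.isUnit_iff_isUnit_det _).mp g.isUnit).ne_zero
  · intro D _ g hg
    rw [hdiag g D hg, Matrix.det_diagonal, Finset.prod_inv_distrib]
  · rintro ⟨i, j, hij, c⟩ g hg
    have hg' : (g : Matrix (Fin N) (Fin N) ℂ) = Matrix.transvection i j c := hg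
    have hD : (Matrix.diagonal (Function.update (1 : Fin N → ℂ) i 2)).det ≠ 0 := by
      rw [Matrix.det_diagonal, Finset.prod_ne_zero_iff]
      intro k _
      rw [Function.update_apply]
      split_ifs <;> simp
    let D := Matrix.GeneralLinearGroup.mkOfDetNeZero _ hD
    -- Conjugation by `D` doubles the parameter of the transvection.
    have hcomm : D * g = g * g * D := by
      refine Units.ext ?_
      change Matrix.diagonal (Function.update (1 : Fin N → ℂ) i 2) * (g : Matrix _ _ ℂ) =
        (g : Matrix _ _ ℂ) * (g : Matrix _ _ ℂ) *
          Matrix.diagonal (Function.update (1 : Fin N → ℂ) i 2)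
      rw [hg', Matrix.transvection_mul_transvection_same i j hij]
      ext k l
      rw [Matrix.diagonal_mul, Matrix.mul_diagonal]
      simp only [Matrix.transvection, Matrix.add_apply, Matrix.one_apply, Matrix.single_apply,
        Function.update_apply, Pi.one_apply]
      by_cases hk : k = i
      · subst hk
        by_cases hl : k = l
        · subst hl
          simp [hij.symm]
        · by_cases hjl : j = l
          · subst hjl
            simp [hij, hij.symm]
            ring
          · simp [hl, hjl]
      · by_cases hl : k = l
        · subst hl
          simp [hk, Ne.symm hk]
        · simp [hk, hl, Ne.symm hk]
    have h1 := congrArg χ hcomm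
    rw [hmul, hmul, hmul, mul_comm (χ g * χ g)] at h1
    have h2 := mul_left_cancel₀ (hne D) h1
    have h3 : χ g = 1 := mul_left_cancel₀ (hne g) (by rw [mul_one]; exact h2.symm)
    rw [h3]
    exact ((inv_eq_one.mpr (Matrix.det_transvection_of_ne i j hij c))).symm
  · intro A B hA hB hPA hPB g hg
    have : g = Matrix.GeneralLinearGroup.mkOfDetNeZero A hA *
        Matrix.GeneralLinearGroup.mkOfDetNeZero B hB := Units.ext hg
    rw [this, hmul, hPA _ rfl, hPB _ rfl, Matrix.det_mul, mul_inv]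

/-- A generator of the line `Ext^N_S(S / 𝔪, S)`. -/
def extGen (N : ℕ) : ExtPow N N 1 := (exists_isExtGenerator_maxIdeal N).choose

theorem isExtGenerator_extGen (N : ℕ) : IsExtGenerator (maxIdeal N ^ 1) N (extGen N) :=
  (exists_isExtGenerator_maxIdeal N).choose_spec.1

theorem C_smul_ext {N n : ℕ} {X Y : ModuleCat.{0} (Poly N)} (c : ℂ) (z : Abelian.Ext.{0} X Y n) :
    (MvPolynomial.C c : Poly N) • z = c • z := by
  rw [Abelian.Ext.smul_eq_comp_mk₀, Abelian.Ext.smul_eq_comp_mk₀]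
  rfl

theorem bijective_toSpanSingleton_extGen (N : ℕ) :
    Function.Bijective (LinearMap.toSpanSingleton ℂ (ExtPow N N 1) (extGen N)) := by
  have he := isExtGenerator_extGen N
  constructor
  · refine (injective_iff_map_eq_zero _).mpr fun c hc => ?_
    rw [LinearMap.toSpanSingleton_apply, ← C_smul_ext, he.smul_eq_zero_iff,
      MvPolynomial.C_mem_pow_idealOfVars_iff] at hc
    exact hc.resolve_right one_ne_zero
  · intro z
    obtain ⟨s, rfl⟩ := he.exists_smul z
    refine ⟨MvPolynomial.constantCoeff s, ?_⟩
    rw [LinearMap.toSpanSingleton_apply, ← C_smul_ext, ← sub_eq_zero, ← sub_smul,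
      he.smul_eq_zero_iff, MvPolynomial.mem_pow_idealOfVars_iff']
    intro x hx
    have : x = 0 := by rwa [Nat.lt_one_iff, Finsupp.degree_eq_zero_iff] at hx
    simp [this, MvPolynomial.constantCoeff_eq]

/-- The coordinate on the line `Ext^N_S(S / 𝔪, S)` given by the generator `extGen N`. -/
def extCoord (N : ℕ) : ExtPow N N 1 ≃ₗ[ℂ] ℂ :=
  (LinearEquiv.ofBijective _ (bijective_toSpanSingleton_extGen N)).symm

theorem extCoord_smul_extGen {N : ℕ} (z : ExtPow N N 1) : extCoord N z • extGen N = z :=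
  (LinearEquiv.ofBijective _ (bijective_toSpanSingleton_extGen N)).apply_symm_apply z

theorem extCoord_extGen (N : ℕ) : extCoord N (extGen N) = 1 :=
  (bijective_toSpanSingleton_extGen N).1 (by
    simp only [LinearMap.toSpanSingleton_apply, extCoord_smul_extGen, one_smul])

/-- The group `GL_N(ℂ)` acts on `Ext^N_S(S / 𝔪, S)` by the inverse of the determinant. -/
theorem extAct_one (N : ℕ) (g : GL (Fin N) ℂ) (z : ExtPow N N 1) :
    extAct N N 1 g z = (g : Matrix (Fin N) (Fin N) ℂ).det⁻¹ • z := by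
  have hgen : ∀ g, extAct N N 1 g (extGen N) = extCoord N (extAct N N 1 g (extGen N)) • extGen N :=
    fun g => (extCoord_smul_extGen _).symm
  have hχ := eq_det_inv_of_diagonal (fun g => extCoord N (extAct N N 1 g (extGen N))) ?_ ?_ g
  · rw [← hχ]
    conv_lhs => rw [← extCoord_smul_extGen z, map_smul, hgen g, smul_comm, extCoord_smul_extGen z]
  · intro g h
    rw [extAct_mul, hgen h, map_smul, map_smul, smul_eq_mul, mul_comm, ← hgen h]
  · intro g t hg
    rw [show extAct N N 1 g (extGen N) = _ from
      (exists_isExtGenerator_maxIdeal N).choose_spec.2 g t hg, map_smul]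
    change _ • extCoord N (extGen N) = _
    rw [extCoord_extGen, smul_eq_mul, mul_one]

/-! ### The filtration of local cohomology by the powers of the maximal ideal -/

/-- The exponents of the monomials of degree `d`. -/
abbrev DegExp (N d : ℕ) : Type := {a : Fin N →₀ ℕ // a.degree = d}

instance (N d : ℕ) : Finite (DegExp N d) :=
  Set.Finite.subset (Finsupp.finite_of_degree_le d) fun _ ha => le_of_eq ha

instance (N d : ℕ) : Fintype (DegExp N d) := Fintype.ofFinite _

theorem homogeneousComponent_mem_pow {N : ℕ} (d : ℕ) (f : Poly N) :
    MvPolynomial.homogeneousComponent d f ∈ maxIdeal N ^ d := by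
  rw [MvPolynomial.mem_pow_idealOfVars_iff']
  intro x hx
  rw [MvPolynomial.coeff_homogeneousComponent, if_neg hx.ne]

/-- Multiplication by the component of degree `d` of `f`, as a map `S / 𝔪 ⟶ S / 𝔪 ^ (d + 1)`. -/
def mulHom {N : ℕ} (d : ℕ) (f : Poly N) : quotPow N 1 ⟶ quotPow N (d + 1) :=
  ModuleCat.ofHom (Submodule.mapQ (maxIdeal N ^ 1) (maxIdeal N ^ (d + 1))
    (LinearMap.lsmul (Poly N) (Poly N) (MvPolynomial.homogeneousComponent d f)) (by
      intro m hm
      change MvPolynomial.homogeneousComponent d f * m ∈ maxIdeal N ^ (d + 1)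
      rw [pow_add]
      exact Ideal.mul_mem_mul (homogeneousComponent_mem_pow d f) hm))

theorem mulHom_mk {N : ℕ} (d : ℕ) (f s : Poly N) :
    (mulHom d f).hom (Ideal.Quotient.mk (maxIdeal N ^ 1) s) =
      Ideal.Quotient.mk (maxIdeal N ^ (d + 1)) (MvPolynomial.homogeneousComponent d f * s) := rfl

theorem mulHom_add {N : ℕ} (d : ℕ) (f f' : Poly N) :
    mulHom d (f + f') = mulHom d f + mulHom d f' := by
  refine ModuleCat.hom_ext (LinearMap.ext fun m => ?_)
  obtain ⟨m, rfl⟩ := Ideal.Quotient.mk_surjective m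
  rw [ModuleCat.hom_add, LinearMap.add_apply, mulHom_mk, mulHom_mk, mulHom_mk, map_add, add_mul,
    map_add]

theorem mulHom_smul {N : ℕ} (d : ℕ) (c : ℂ) (f : Poly N) :
    mulHom d (c • f) = (MvPolynomial.C c : Poly N) • mulHom d f := by
  refine ModuleCat.hom_ext (LinearMap.ext fun m => ?_)
  obtain ⟨m, rfl⟩ := Ideal.Quotient.mk_surjective m
  rw [mulHom_mk, map_smul, MvPolynomial.smul_eq_C_mul, mul_assoc]
  rfl

theorem mulHom_comp_proj {N : ℕ} (d : ℕ) (f : Poly N) :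
    mulHom d f ≫ quotPowProj N (Nat.le_succ d) = 0 := by
  refine ModuleCat.hom_ext (LinearMap.ext fun m => ?_)
  obtain ⟨m, rfl⟩ := Ideal.Quotient.mk_surjective m
  exact Ideal.Quotient.eq_zero_iff_mem.mpr
    (Ideal.mul_mem_right m (maxIdeal N ^ d) (homogeneousComponent_mem_pow d f))

/-- The direct sum of copies of `S / 𝔪` indexed by the monomials of degree `d`, which is isomorphic
to `𝔪 ^ d / 𝔪 ^ (d + 1)`. -/
abbrev monomialMod (N d : ℕ) : ModuleCat.{0} (Poly N) :=
  ModuleCat.of (Poly N) (DegExp N d → Poly N ⧸ maxIdeal N ^ 1)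

/-- The projection of `monomialMod N d` to a component. -/
def monomialProj {N d : ℕ} (a : DegExp N d) : monomialMod N d ⟶ quotPow N 1 :=
  ModuleCat.ofHom (LinearMap.proj a)

/-- The inclusion of a component of `monomialMod N d`. -/
def monomialIncl {N d : ℕ} (a : DegExp N d) : quotPow N 1 ⟶ monomialMod N d :=
  ModuleCat.ofHom (LinearMap.single (Poly N) (fun _ : DegExp N d => Poly N ⧸ maxIdeal N ^ 1) a)

theorem monomialIncl_comp_proj {N d : ℕ} (a b : DegExp N d) :
    monomialIncl a ≫ monomialProj b = if a = b then 𝟙 (quotPow N 1) else 0 := by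
  refine ModuleCat.hom_ext (LinearMap.ext fun m => ?_)
  change Pi.single (M := fun _ : DegExp N d => Poly N ⧸ maxIdeal N ^ 1) a m b = _
  split_ifs with h
  · subst h
    exact Pi.single_eq_same _ _
  · exact Pi.single_eq_of_ne (Ne.symm h) _

theorem sum_proj_comp_incl (N d : ℕ) :
    ∑ a, monomialProj a ≫ monomialIncl a = 𝟙 (monomialMod N d) := by
  refine ModuleCat.hom_ext (LinearMap.ext fun m => ?_)
  rw [ModuleCat.hom_sum, LinearMap.sum_apply]
  exact Finset.univ_sum_single m

theorem ext_monomialMod_eq_sum {N d n : ℕ} (z : Abelian.Ext.{0} (monomialMod N d) (polyMod N) n) :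
    z = ∑ a, (Abelian.Ext.mk₀ (monomialProj a)).comp
      ((Abelian.Ext.mk₀ (monomialIncl a)).comp z (zero_add n)) (zero_add n) := by
  conv_lhs => rw [← Abelian.Ext.mk₀_id_comp z, ← sum_proj_comp_incl, Abelian.Ext.mk₀_sum,
    Abelian.Ext.sum_comp]
  simp only [Abelian.Ext.mk₀_comp_mk₀_assoc]

/-- The map `monomialMod N d ⟶ S / 𝔪 ^ (d + 1)` given by the monomials of degree `d`. -/
def monomialMap (N d : ℕ) : monomialMod N d ⟶ quotPow N (d + 1) :=
  ∑ a, monomialProj a ≫ mulHom d (MvPolynomial.monomial a.1 1)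

theorem monomialIncl_comp_map {N d : ℕ} (a : DegExp N d) :
    monomialIncl a ≫ monomialMap N d = mulHom d (MvPolynomial.monomial a.1 1) := by
  classical
  rw [monomialMap, Preadditive.comp_sum, Finset.sum_eq_single a]
  · rw [← Category.assoc, monomialIncl_comp_proj, if_pos rfl, Category.id_comp]
  · intro b _ hb
    rw [← Category.assoc, monomialIncl_comp_proj, if_neg (Ne.symm hb), Limits.zero_comp]
  · simp

theorem homogeneousComponent_monomial {N d : ℕ} (a : DegExp N d) :
    MvPolynomial.homogeneousComponent d (MvPolynomial.monomial a.1 (1 : ℂ)) =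
      MvPolynomial.monomial a.1 1 := by
  rw [MvPolynomial.homogeneousComponent_of_mem
    (MvPolynomial.isHomogeneous_monomial (1 : ℂ) a.2), if_pos rfl]

theorem monomialMap_mk {N d : ℕ} (s : DegExp N d → Poly N) :
    (monomialMap N d).hom (fun a => Ideal.Quotient.mk (maxIdeal N ^ 1) (s a)) =
      Ideal.Quotient.mk (maxIdeal N ^ (d + 1)) (∑ a, MvPolynomial.monomial a.1 1 * s a) := by
  rw [monomialMap, ModuleCat.hom_sum, LinearMap.sum_apply, map_sum]
  refine Finset.sum_congr rfl fun a _ => ?_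
  change (mulHom d (MvPolynomial.monomial a.1 1)).hom (Ideal.Quotient.mk _ (s a)) = _
  rw [mulHom_mk, homogeneousComponent_monomial]

/-- The short complex `𝔪 ^ d / 𝔪 ^ (d + 1) → S / 𝔪 ^ (d + 1) → S / 𝔪 ^ d`. -/
abbrev powComplex (N d : ℕ) : ShortComplex (ModuleCat.{0} (Poly N)) :=
  ShortComplex.mk (monomialMap N d) (quotPowProj N (Nat.le_succ d)) (by
    rw [monomialMap, Preadditive.sum_comp]
    exact Finset.sum_eq_zero fun a _ => by
      rw [Category.assoc, mulHom_comp_proj, Limits.comp_zero])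

theorem coeff_sum_monomial_mul {N d : ℕ} (s : DegExp N d → Poly N) (b : DegExp N d) :
    (∑ a : DegExp N d, MvPolynomial.monomial a.1 1 * s a).coeff b.1 = (s b).coeff 0 := by
  rw [MvPolynomial.coeff_sum, Finset.sum_eq_single b]
  · rw [MvPolynomial.coeff_monomial_mul', if_pos le_rfl, one_mul, tsub_self]
  · intro a _ ha
    rw [MvPolynomial.coeff_monomial_mul', if_neg]
    intro hle
    obtain ⟨c, hc⟩ := exists_add_of_le hle
    have h1 := congrArg Finsupp.degree hc
    rw [map_add, a.2, b.2] at h1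
    have h2 : c = 0 := (Finsupp.degree_eq_zero_iff c).mp (by lia)
    exact ha (Subtype.ext (by rw [hc, h2, add_zero]))
  · simp

theorem powComplex_shortExact (N d : ℕ) : (powComplex N d).ShortExact := by
  refine ModuleCat.shortComplex_shortExact _ ?_ ?_ ?_
  · intro m
    refine ⟨fun hm => ?_, ?_⟩
    · obtain ⟨m, rfl⟩ := Ideal.Quotient.mk_surjective m
      have hm' : m ∈ maxIdeal N ^ d := Ideal.Quotient.eq_zero_iff_mem.mp hm
      rw [MvPolynomial.mem_pow_idealOfVars_iff'] at hm'
      refine ⟨fun a => Ideal.Quotient.mk _ (MvPolynomial.C (m.coeff a.1)), ?_⟩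
      refine (monomialMap_mk _).trans (Ideal.Quotient.eq.mpr ?_)
      rw [MvPolynomial.mem_pow_idealOfVars_iff']
      intro x hx
      rw [MvPolynomial.coeff_sub]
      rcases Nat.lt_succ_iff_lt_or_eq.mp hx with h | h
      · rw [hm' x h, sub_zero, MvPolynomial.coeff_sum]
        refine Finset.sum_eq_zero fun a _ => ?_
        rw [MvPolynomial.coeff_monomial_mul', if_neg]
        intro hle
        have := Finsupp.degree_mono hle
        rw [a.2] at this
        lia
      · rw [coeff_sum_monomial_mul _ (⟨x, h⟩ : DegExp N d), MvPolynomial.coeff_zero_C, sub_self]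
    · rintro ⟨m, rfl⟩
      exact congrArg (fun f : monomialMod N d ⟶ quotPow N d => f.hom m) (powComplex N d).zero
  · refine (injective_iff_map_eq_zero (powComplex N d).f.hom).mpr fun m hm => ?_
    have hs : ∀ a, ∃ s : Poly N, Ideal.Quotient.mk (maxIdeal N ^ 1) s = m a :=
      fun a => Ideal.Quotient.mk_surjective (m a)
    choose s hs using hs
    obtain rfl : (fun a => Ideal.Quotient.mk (maxIdeal N ^ 1) (s a)) = m := funext hs
    have h1 := Ideal.Quotient.eq_zero_iff_mem.mp ((monomialMap_mk s).symm.trans hm)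
    rw [MvPolynomial.mem_pow_idealOfVars_iff'] at h1
    funext a
    refine Ideal.Quotient.eq_zero_iff_mem.mpr ?_
    rw [MvPolynomial.mem_pow_idealOfVars_iff']
    intro x hx
    have : x = 0 := by rwa [Nat.lt_one_iff, Finsupp.degree_eq_zero_iff] at hx
    rw [this, ← coeff_sum_monomial_mul s a]
    exact h1 _ (by rw [a.2]; exact Nat.lt_succ_self d)
  · intro m
    obtain ⟨m, rfl⟩ := Ideal.Quotient.mk_surjective m
    exact ⟨Ideal.Quotient.mk _ m, rfl⟩

theorem ext_monomialMod_eq_zero {N d j : ℕ} (hj : j ≠ N)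
    (z : Abelian.Ext.{0} (monomialMod N d) (polyMod N) j) : z = 0 := by
  rw [ext_monomialMod_eq_sum z]
  refine Finset.sum_eq_zero fun a _ => ?_
  rw [(isExtGenerator_extGen N).eq_zero j hj ((Abelian.Ext.mk₀ (monomialIncl a)).comp z _),
    Abelian.Ext.comp_zero]

theorem subsingleton_extPow_zero (N j : ℕ) : Subsingleton (ExtPow N j 0) := by
  refine subsingleton_of_forall_eq 0 fun z => ?_
  have h1 : (𝟙 (quotPow N 0)) = 0 := by
    refine ModuleCat.hom_ext (LinearMap.ext fun m => ?_)
    obtain ⟨m, rfl⟩ := Ideal.Quotient.mk_surjective m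
    refine Ideal.Quotient.eq_zero_iff_mem.mpr ?_
    rw [pow_zero, Ideal.one_eq_top]
    trivial
  rw [← Abelian.Ext.mk₀_id_comp z, h1, Abelian.Ext.mk₀_zero, Abelian.Ext.zero_comp]

theorem extPow_eq_zero {N j : ℕ} (hj : j ≠ N) (d : ℕ) (z : ExtPow N j d) : z = 0 := by
  induction d with
  | zero => exact (subsingleton_extPow_zero N j).elim _ _
  | succ d ih =>
    obtain ⟨y, rfl⟩ := Abelian.Ext.contravariant_sequence_exact₂ (powComplex_shortExact N d) _ z
      (ext_monomialMod_eq_zero hj _)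
    rw [ih y, Abelian.Ext.comp_zero]

theorem extTransition_apply {N j d d' : ℕ} (h : d ≤ d') (z : ExtPow N j d) :
    extTransition N j d d' h z = (Abelian.Ext.mk₀ (quotPowProj N h)).comp z (zero_add j) := rfl

theorem extTransition_succ_injective (N d : ℕ) :
    Function.Injective (extTransition N N d (d + 1) (Nat.le_succ d)) := by
  refine (injective_iff_map_eq_zero _).mpr fun z hz => ?_
  -- The connecting map starts from the group in degree `N - 1`, so `N = 0` is treated apart.
  rcases N with _ | N
  · have := (powComplex_shortExact 0 d).epi_g
    exact (injective_iff_map_eq_zero _).mp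
      (Abelian.Ext.precomp_mk₀_injective_of_epi (polyMod 0) (powComplex 0 d).g) z hz
  · obtain ⟨y, rfl⟩ := Abelian.Ext.contravariant_sequence_exact₃ (powComplex_shortExact _ d) _ z hz
      (add_comm 1 N)
    rw [ext_monomialMod_eq_zero (by lia) y, Abelian.Ext.comp_zero]

/-- The pairing of a class in `Ext^N_S(S / 𝔪 ^ (d + 1), S)` with polynomials of degree `d`: the
polynomial `f` defines a multiplication map `S / 𝔪 ⟶ S / 𝔪 ^ (d + 1)`, along which the class is
pulled back to the line `Ext^N_S(S / 𝔪, S)`. -/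
def pairing {N : ℕ} (d : ℕ) : ExtPow N N (d + 1) →ₗ[ℂ] Poly N →ₗ[ℂ] ℂ :=
  LinearMap.mk₂ ℂ
    (fun h f => extCoord N ((Abelian.Ext.mk₀ (mulHom d f)).comp h (zero_add N)))
    (fun h h' f => by rw [Abelian.Ext.comp_add, map_add])
    (fun c h f => by rw [Abelian.Ext.comp_smul, map_smul])
    (fun h f f' => by rw [mulHom_add, Abelian.Ext.mk₀_add, Abelian.Ext.add_comp, map_add])
    (fun c h f => by
      rw [mulHom_smul, Abelian.Ext.mk₀_smul, Abelian.Ext.smul_comp, C_smul_ext, map_smul])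

theorem pairing_apply {N d : ℕ} (h : ExtPow N N (d + 1)) (f : Poly N) :
    pairing d h f = extCoord N ((Abelian.Ext.mk₀ (mulHom d f)).comp h (zero_add N)) := rfl

theorem pairing_transition {N d : ℕ} (z : ExtPow N N d) :
    pairing d (extTransition N N d (d + 1) (Nat.le_succ d) z) = 0 := by
  refine LinearMap.ext fun f => ?_
  rw [pairing_apply, extTransition_apply, Abelian.Ext.mk₀_comp_mk₀_assoc, mulHom_comp_proj,
    Abelian.Ext.mk₀_zero, Abelian.Ext.zero_comp, map_zero, LinearMap.zero_apply]

/-- The kernel of the pairing is the image of `Ext^N_S(S / 𝔪 ^ d, S)`. -/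
theorem exists_transition_eq {N d : ℕ} (h : ExtPow N N (d + 1))
    (h0 : ∀ a : DegExp N d, pairing d h (MvPolynomial.monomial a.1 1) = 0) :
    ∃ z : ExtPow N N d, extTransition N N d (d + 1) (Nat.le_succ d) z = h := by
  refine Abelian.Ext.contravariant_sequence_exact₂ (powComplex_shortExact N d) _ h ?_
  change (Abelian.Ext.mk₀ (monomialMap N d)).comp h (zero_add N) = 0
  rw [ext_monomialMod_eq_sum ((Abelian.Ext.mk₀ (monomialMap N d)).comp h (zero_add N))]
  refine Finset.sum_eq_zero fun a _ => ?_
  rw [Abelian.Ext.mk₀_comp_mk₀_assoc (monomialIncl a), monomialIncl_comp_map,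
    (extCoord N).map_eq_zero_iff.mp (h0 a), Abelian.Ext.comp_zero]

/-- Every functional on forms of degree `d` is the pairing with a class, because `Ext^{N+1}` of
`S / 𝔪 ^ d` vanishes. -/
theorem exists_pairing_eq {N d : ℕ} (φ : DegExp N d → ℂ) :
    ∃ h : ExtPow N N (d + 1), ∀ a : DegExp N d,
      pairing d h (MvPolynomial.monomial a.1 1) = φ a := by
  classical
  obtain ⟨h, hh⟩ := Abelian.Ext.contravariant_sequence_exact₁ (powComplex_shortExact N d)
    (polyMod N) (∑ a, (Abelian.Ext.mk₀ (monomialProj a)).comp ((extCoord N).symm (φ a))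
      (zero_add N)) rfl (extPow_eq_zero (by lia) d _)
  refine ⟨h, fun a => ?_⟩
  rw [pairing_apply, ← monomialIncl_comp_map, ← Abelian.Ext.mk₀_comp_mk₀_assoc, hh,
    Abelian.Ext.comp_sum, Finset.sum_eq_single a]
  · rw [Abelian.Ext.mk₀_comp_mk₀_assoc, monomialIncl_comp_proj, if_pos rfl,
      Abelian.Ext.mk₀_id_comp, LinearEquiv.apply_symm_apply]
  · intro b _ hb
    rw [Abelian.Ext.mk₀_comp_mk₀_assoc, monomialIncl_comp_proj, if_neg (Ne.symm hb),
      Abelian.Ext.mk₀_zero, Abelian.Ext.zero_comp]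
  · simp

theorem coordChange_isHomogeneous {N d : ℕ} (g : GL (Fin N) ℂ) {f : Poly N}
    (hf : f.IsHomogeneous d) : (coordChange g f).IsHomogeneous d := by
  have h := hf.aeval (S := ℂ) (τ := Fin N) (n := 1) (fun j => ∑ i,
    MvPolynomial.C ((g : Matrix (Fin N) (Fin N) ℂ) i j) * MvPolynomial.X i) ?_
  · rwa [one_mul] at h
  · intro j
    refine MvPolynomial.IsHomogeneous.sum _ _ _ fun i _ => ?_
    simpa using (MvPolynomial.isHomogeneous_C (Fin N) _).mul (MvPolynomial.isHomogeneous_X ℂ i)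

theorem homogeneousComponent_eq_self {N d : ℕ} {f : Poly N} (hf : f.IsHomogeneous d) :
    MvPolynomial.homogeneousComponent d f = f := by
  rw [MvPolynomial.homogeneousComponent_of_mem hf, if_pos rfl]

/-- The pairing is equivariant up to the character by which `GL_N(ℂ)` acts on the line
`Ext^N_S(S / 𝔪, S)`. -/
theorem pairing_extAct {N d : ℕ} (g : GL (Fin N) ℂ) (h : ExtPow N N (d + 1)) {f : Poly N}
    (hf : f.IsHomogeneous d) :
    pairing d (extAct N N (d + 1) g h) f =
      (g : Matrix (Fin N) (Fin N) ℂ).det⁻¹ * pairing d h (coordChange g⁻¹ f) := by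
  have key : quotAct g 1 ≫ (twist g).map (mulHom d (coordChange g⁻¹ f)) =
      mulHom d f ≫ quotAct g (d + 1) := by
    refine ModuleCat.hom_ext (LinearMap.ext fun m => ?_)
    obtain ⟨m, rfl⟩ := Ideal.Quotient.mk_surjective m
    refine congrArg (Ideal.Quotient.mk (maxIdeal N ^ (d + 1)))
      (?_ : MvPolynomial.homogeneousComponent d (coordChange g⁻¹ f) * coordChange g⁻¹ m =
        coordChange g⁻¹ (MvPolynomial.homogeneousComponent d f * m))
    rw [homogeneousComponent_eq_self hf,
      homogeneousComponent_eq_self (coordChange_isHomogeneous g⁻¹ hf), map_mul]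
  rw [pairing_apply, extAct_eq_twistAct, ← twistAct_precomp g key, ← extAct_eq_twistAct,
    extAct_one, map_smul, smul_eq_mul, pairing_apply]

/-! ### Weight spaces of the dilation by two -/

/-- The scalar matrix `2`. Its eigenvalues on graded pieces of different degrees differ. -/
def dilation (N : ℕ) : GL (Fin N) ℂ :=
  Matrix.GeneralLinearGroup.mkOfDetNeZero (Matrix.diagonal fun _ => 2) (by simp)

theorem coe_dilation (N : ℕ) :
    (dilation N : Matrix (Fin N) (Fin N) ℂ) = Matrix.diagonal fun _ => 2 := rfl

theorem mul_dilation {N : ℕ} (g : GL (Fin N) ℂ) : g * dilation N = dilation N * g := by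
  refine Units.ext ?_
  rw [Units.val_mul, Units.val_mul, coe_dilation]
  ext i j
  rw [Matrix.mul_diagonal, Matrix.diagonal_mul, mul_comm]

theorem coordChange_dilation_inv {N d : ℕ} {f : Poly N} (hf : f.IsHomogeneous d) :
    coordChange (dilation N)⁻¹ f = ((2 : ℂ)⁻¹ ^ d) • f := by
  have h : coordChange (dilation N)⁻¹ =
      MvPolynomial.aeval fun j => MvPolynomial.C (2 : ℂ)⁻¹ * MvPolynomial.X j := by
    ext1 j
    rw [coordChange_inv_X_of_diagonal (coe_dilation N), MvPolynomial.aeval_X]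
  have hmon : ∀ a ∈ f.support,
      coordChange (dilation N)⁻¹ (MvPolynomial.monomial a (f.coeff a)) =
        ((2 : ℂ)⁻¹ ^ d) • MvPolynomial.monomial a (f.coeff a) := by
    intro a ha
    have hd : a.degree = d := by
      rw [Finsupp.degree_eq_weight_one]; exact hf (MvPolynomial.mem_support_iff.mp ha)
    rw [h, MvPolynomial.aeval_monomial, Finsupp.prod, MvPolynomial.algebraMap_eq,
      MvPolynomial.monomial_eq, Finsupp.prod, MvPolynomial.smul_eq_C_mul]
    simp_rw [mul_pow]
    rw [Finset.prod_mul_distrib, Finset.prod_pow_eq_pow_sum, ← Finsupp.degree_apply, hd, map_pow]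
    ring
  conv_lhs => rw [f.as_sum, map_sum, Finset.sum_congr rfl hmon, ← Finset.smul_sum, ← f.as_sum]

/-- The eigenvalue of the dilation by two on the piece of degree `-d - N`. -/
def dilationEigenvalue (N d : ℕ) : ℂ := (2 : ℂ) ^ (-(d : ℤ) - N)

theorem two_zpow_injective : Function.Injective fun k : ℤ => (2 : ℂ) ^ k := by
  intro a b hab
  have h : (2 : ℝ) ^ a = (2 : ℝ) ^ b := by
    have := congrArg (fun z : ℂ => ‖z‖) hab
    simpa using this
  exact zpow_right_injective₀ (by norm_num) (by norm_num) h

theorem dilationEigenvalue_injective (N : ℕ) : Function.Injective (dilationEigenvalue N) := by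
  intro a b hab
  have := two_zpow_injective hab
  lia

theorem dilationEigenvalue_eq (N d : ℕ) :
    ((dilation N : Matrix (Fin N) (Fin N) ℂ).det)⁻¹ * (2 : ℂ)⁻¹ ^ d = dilationEigenvalue N d := by
  rw [coe_dilation, Matrix.det_diagonal, Finset.prod_const, Finset.card_univ, Fintype.card_fin,
    dilationEigenvalue, inv_pow, zpow_sub₀ two_ne_zero, zpow_neg, zpow_natCast, zpow_natCast]
  ring

theorem pairing_dilation {N d : ℕ} (h : ExtPow N N (d + 1)) {f : Poly N}
    (hf : f.IsHomogeneous d) :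
    pairing d (extAct N N (d + 1) (dilation N) h) f = dilationEigenvalue N d * pairing d h f := by
  rw [pairing_extAct _ _ hf, coordChange_dilation_inv hf, map_smul, smul_eq_mul, ← mul_assoc,
    dilationEigenvalue_eq]

theorem isHomogeneous_monomial_degExp {N d : ℕ} (a : DegExp N d) :
    (MvPolynomial.monomial a.1 (1 : ℂ)).IsHomogeneous d :=
  MvPolynomial.isHomogeneous_monomial 1 a.2

theorem extAct_transition_apply {N j : ℕ} (g : GL (Fin N) ℂ) {d d' : ℕ} (h : d ≤ d')
    (z : ExtPow N j d) :
    extAct N j d' g (extTransition N j d d' h z) = extTransition N j d d' h (extAct N j d g z) :=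
  LinearMap.congr_fun (extAct_transition N j g d d' h) z

theorem exists_transition_eq_dilation_sub {N d : ℕ} (h : ExtPow N N (d + 1)) :
    ∃ z : ExtPow N N d, extTransition N N d (d + 1) (Nat.le_succ d) z =
      extAct N N (d + 1) (dilation N) h - dilationEigenvalue N d • h :=
  exists_transition_eq _ fun a => by
    rw [map_sub, map_smul, LinearMap.sub_apply, LinearMap.smul_apply,
      pairing_dilation h (isHomogeneous_monomial_degExp a), smul_eq_mul, sub_self]

/-- The difference of the dilation and a scalar `c` is surjective on `Ext^N_S(S / 𝔪 ^ d, S)` if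
`c` is not an eigenvalue on one of the subquotients of the filtration. -/
theorem exists_dilation_sub_eq {N : ℕ} (d : ℕ) (c : ℂ)
    (hc : ∀ i < d, c ≠ dilationEigenvalue N i) (h : ExtPow N N d) :
    ∃ u : ExtPow N N d, extAct N N d (dilation N) u - c • u = h := by
  induction d with
  | zero => exact ⟨0, (subsingleton_extPow_zero N N).elim _ _⟩
  | succ d ih =>
    have hne : dilationEigenvalue N d - c ≠ 0 := sub_ne_zero.mpr (hc d (Nat.lt_succ_self d)).symm
    -- Dividing by `c_d - c` solves the equation modulo the previous step of the filtration.
    set u₀ := (dilationEigenvalue N d - c)⁻¹ • h with hu₀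
    obtain ⟨z, hz⟩ := exists_transition_eq_dilation_sub u₀
    obtain ⟨u, hu⟩ := ih (fun i hi => hc i (by lia)) z
    refine ⟨u₀ - extTransition N N d (d + 1) (Nat.le_succ d) u, ?_⟩
    have h1 : (dilationEigenvalue N d - c) • u₀ = h := by
      rw [hu₀, smul_smul, mul_inv_cancel₀ hne, one_smul]
    rw [← hu, map_sub, map_smul, ← extAct_transition_apply] at hz
    rw [map_sub, smul_sub, ← h1, sub_smul, sub_sub_sub_comm, hz]
    abel

theorem eq_zero_of_dilation_eq_smul {N : ℕ} (d : ℕ) (c : ℂ)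
    (hc : ∀ i < d, c ≠ dilationEigenvalue N i) (u : ExtPow N N d)
    (hu : extAct N N d (dilation N) u = c • u) : u = 0 := by
  induction d with
  | zero => exact (subsingleton_extPow_zero N N).elim _ _
  | succ d ih =>
    have hne : dilationEigenvalue N d - c ≠ 0 := sub_ne_zero.mpr (hc d (Nat.lt_succ_self d)).symm
    obtain ⟨z, rfl⟩ := exists_transition_eq u fun a => by
      have h1 := pairing_dilation u (isHomogeneous_monomial_degExp a)
      rw [hu, map_smul, LinearMap.smul_apply, smul_eq_mul, eq_comm, ← sub_eq_zero, ← sub_mul] at h1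
      exact (mul_eq_zero.mp h1).resolve_left hne
    rw [extAct_transition_apply, ← map_smul] at hu
    rw [ih (fun i hi => hc i (by lia)) z (extTransition_succ_injective N d hu), map_zero]

/-- The part of degree `-d - N` of `Ext^N_S(S / 𝔪 ^ (d + 1), S)`, defined as an eigenspace of the
dilation by two. It is a complement of the image of `Ext^N_S(S / 𝔪 ^ d, S)`. -/
def weightSpace (N d : ℕ) : Submodule ℂ (ExtPow N N (d + 1)) :=
  Module.End.eigenspace (extAct N N (d + 1) (dilation N)) (dilationEigenvalue N d)

theorem mem_weightSpace {N d : ℕ} {w : ExtPow N N (d + 1)} :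
    w ∈ weightSpace N d ↔
      extAct N N (d + 1) (dilation N) w = dilationEigenvalue N d • w :=
  Module.End.mem_eigenspace_iff

theorem extAct_mem_weightSpace {N d : ℕ} (g : GL (Fin N) ℂ) {w : ExtPow N N (d + 1)}
    (hw : w ∈ weightSpace N d) : extAct N N (d + 1) g w ∈ weightSpace N d := by
  rw [mem_weightSpace] at hw ⊢
  rw [← extAct_mul, ← mul_dilation, extAct_mul, hw, map_smul]

/-- The weight space of degree `-d - N` and the previous step of the filtration span. -/
theorem exists_eq_add_transition {N d : ℕ} (h : ExtPow N N (d + 1)) :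
    ∃ w ∈ weightSpace N d, ∃ u : ExtPow N N d,
      h = w + extTransition N N d (d + 1) (Nat.le_succ d) u := by
  obtain ⟨z, hz⟩ := exists_transition_eq_dilation_sub h
  obtain ⟨u, hu⟩ := exists_dilation_sub_eq d (dilationEigenvalue N d)
    (fun i hi heq => hi.ne' (dilationEigenvalue_injective N heq)) z
  refine ⟨h - extTransition N N d (d + 1) (Nat.le_succ d) u, ?_, u, by abel⟩
  rw [← hu, map_sub, map_smul, ← extAct_transition_apply] at hz
  rw [mem_weightSpace, map_sub, smul_sub, ← sub_eq_zero, sub_sub_sub_comm, hz, sub_self]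

theorem eq_zero_of_mem_weightSpace {N d : ℕ} {w : ExtPow N N (d + 1)} (hw : w ∈ weightSpace N d)
    (h0 : ∀ a : DegExp N d, pairing d w (MvPolynomial.monomial a.1 1) = 0) : w = 0 := by
  obtain ⟨u, rfl⟩ := exists_transition_eq w h0
  rw [mem_weightSpace, extAct_transition_apply, ← map_smul] at hw
  rw [eq_zero_of_dilation_eq_smul d (dilationEigenvalue N d)
    (fun i hi heq => hi.ne' (dilationEigenvalue_injective N heq)) u
    (extTransition_succ_injective N d hw), map_zero]

/-! ### Powers of linear forms -/

/-- The linear form with coefficients `v`. -/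
def linForm {N : ℕ} (v : Fin N → ℂ) : Poly N := ∑ i, MvPolynomial.C (v i) * MvPolynomial.X i

theorem coordChange_X {N : ℕ} (g : GL (Fin N) ℂ) (j : Fin N) :
    coordChange g (MvPolynomial.X j) =
      linForm fun i => (g : Matrix (Fin N) (Fin N) ℂ) i j := by
  simp [coordChange, linForm]

theorem eval_linForm {N : ℕ} (v y : Fin N → ℂ) :
    MvPolynomial.eval y (linForm v) = ∑ i, v i * y i := by
  simp [linForm]

theorem linForm_isHomogeneous {N : ℕ} (v : Fin N → ℂ) : (linForm v).IsHomogeneous 1 :=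
  MvPolynomial.IsHomogeneous.sum _ _ _ fun i _ => by
    simpa using (MvPolynomial.isHomogeneous_C (Fin N) _).mul (MvPolynomial.isHomogeneous_X ℂ i)

theorem linForm_pow_isHomogeneous {N : ℕ} (v : Fin N → ℂ) (d : ℕ) :
    (linForm v ^ d).IsHomogeneous d := by
  simpa using (linForm_isHomogeneous v).pow d

/-- The exponent with prescribed values. -/
abbrev expOf {N : ℕ} (k : Fin N → ℕ) : Fin N →₀ ℕ := Finsupp.equivFunOnFinite.symm k

theorem linForm_pow {N : ℕ} (v : Fin N → ℂ) (d : ℕ) :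
    linForm v ^ d = ∑ k ∈ Finset.univ.piAntidiag d,
      ((Nat.multinomial Finset.univ k : ℂ) * ∏ i, v i ^ k i) •
        MvPolynomial.monomial (expOf k) (1 : ℂ) := by
  rw [linForm, Finset.sum_pow_eq_sum_piAntidiag]
  refine Finset.sum_congr rfl fun k _ => ?_
  simp_rw [mul_pow]
  rw [Finset.prod_mul_distrib, MvPolynomial.smul_eq_C_mul, MvPolynomial.monomial_eq,
    Finsupp.prod_fintype _ _ (fun i => pow_zero _)]
  simp only [map_mul, map_natCast, map_prod, map_pow, map_one, one_mul,
    Finsupp.equivFunOnFinite_symm_apply_apply]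
  ring

/-- A linear functional on forms of degree `d`, evaluated on the powers `(∑ y_i X_i) ^ d`, as a
polynomial in `y`. -/
def powPoly {N : ℕ} (d : ℕ) (φ : Poly N →ₗ[ℂ] ℂ) : Poly N :=
  ∑ k ∈ Finset.univ.piAntidiag d, MvPolynomial.monomial (expOf k)
    ((Nat.multinomial Finset.univ k : ℂ) * φ (MvPolynomial.monomial (expOf k) 1))

theorem eval_powPoly {N : ℕ} (d : ℕ) (φ : Poly N →ₗ[ℂ] ℂ) (y : Fin N → ℂ) :
    MvPolynomial.eval y (powPoly d φ) = φ (linForm y ^ d) := by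
  rw [linForm_pow, powPoly, map_sum, map_sum]
  refine Finset.sum_congr rfl fun k _ => ?_
  rw [MvPolynomial.eval_monomial, Finsupp.prod_fintype _ _ (fun i => pow_zero _), map_smul,
    smul_eq_mul]
  simp only [Finsupp.equivFunOnFinite_symm_apply_apply]
  ring

theorem degree_expOf {N d : ℕ} {k : Fin N → ℕ} (hk : k ∈ Finset.univ.piAntidiag d) :
    (expOf k).degree = d := by
  rw [Finsupp.degree_eq_sum]
  exact (Finset.mem_piAntidiag.mp hk).1

theorem powPoly_isHomogeneous {N : ℕ} (d : ℕ) (φ : Poly N →ₗ[ℂ] ℂ) :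
    (powPoly d φ).IsHomogeneous d :=
  MvPolynomial.IsHomogeneous.sum _ _ _ fun _ hk =>
    MvPolynomial.isHomogeneous_monomial _ (degree_expOf hk)

theorem coeff_powPoly {N d : ℕ} (φ : Poly N →ₗ[ℂ] ℂ) (a : DegExp N d) :
    (powPoly d φ).coeff a.1 =
      (Nat.multinomial Finset.univ a.1 : ℂ) * φ (MvPolynomial.monomial a.1 1) := by
  have ha : expOf (a.1 : Fin N → ℕ) = a.1 := Finsupp.equivFunOnFinite.symm_apply_apply a.1
  rw [powPoly, MvPolynomial.coeff_sum, Finset.sum_eq_single (a.1 : Fin N → ℕ)]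
  · rw [MvPolynomial.coeff_monomial, if_pos ha, ha]
  · intro k _ hk
    rw [MvPolynomial.coeff_monomial, if_neg]
    intro h
    exact hk (by rw [← h]; rfl)
  · intro h
    refine absurd (Finset.mem_piAntidiag.mpr ⟨?_, fun i _ => Finset.mem_univ i⟩) h
    rw [← Finsupp.degree_eq_sum, a.2]

theorem linearMap_eq_on_homogeneous {N d : ℕ} {M : Type*} [AddCommGroup M] [Module ℂ M]
    {φ ψ : Poly N →ₗ[ℂ] M} (h : ∀ a : DegExp N d, φ (MvPolynomial.monomial a.1 1) =
      ψ (MvPolynomial.monomial a.1 1)) {f : Poly N} (hf : f.IsHomogeneous d) : φ f = ψ f := by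
  rw [f.as_sum, map_sum, map_sum]
  refine Finset.sum_congr rfl fun a ha => ?_
  have hd : a.degree = d := by
    rw [Finsupp.degree_eq_weight_one]; exact hf (MvPolynomial.mem_support_iff.mp ha)
  have : MvPolynomial.monomial a (f.coeff a) = f.coeff a • MvPolynomial.monomial a (1 : ℂ) := by
    rw [MvPolynomial.smul_monomial, smul_eq_mul, mul_one]
  rw [this, map_smul, map_smul, h ⟨a, hd⟩]

/-- A linear functional that vanishes on the powers `(∑ v_i X_i) ^ d` with `v_j ≠ 0` vanishes on
forms of degree `d`: its values on these powers are those of a polynomial in `v`, whose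
coefficients are nonzero multiples of the values of the functional on monomials. -/
theorem eq_zero_of_linForm_pow {N d : ℕ} (j : Fin N) (φ : Poly N →ₗ[ℂ] ℂ)
    (h : ∀ v : Fin N → ℂ, v j ≠ 0 → φ (linForm v ^ d) = 0) (a : DegExp N d) :
    φ (MvPolynomial.monomial a.1 1) = 0 := by
  have h1 : MvPolynomial.X j * powPoly d φ = 0 := MvPolynomial.funext fun y => by
    rw [map_mul, MvPolynomial.eval_X, eval_powPoly, map_zero]
    by_cases hy : y j = 0
    · rw [hy, zero_mul]
    · rw [h y hy, mul_zero]
  have h2 := (mul_eq_zero.mp h1).resolve_left (MvPolynomial.X_ne_zero j)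
  have h3 := coeff_powPoly φ a
  rw [h2, MvPolynomial.coeff_zero, eq_comm, mul_eq_zero] at h3
  exact h3.resolve_left (by exact_mod_cast (Nat.multinomial_pos _ _).ne')

/-- The powers of the linear forms with nonzero `j`-th coefficient, which are the translates of
`X_j ^ d` under the general linear group, span the forms of degree `d`. -/
theorem mem_span_linForm_pow {N d : ℕ} (j : Fin N) {f : Poly N} (hf : f.IsHomogeneous d) :
    f ∈ Submodule.span ℂ {p : Poly N | ∃ v : Fin N → ℂ, v j ≠ 0 ∧ linForm v ^ d = p} := by
  by_contra hmem
  obtain ⟨φ, hφ, hle⟩ := Submodule.exists_le_ker_of_notMem hmem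
  refine hφ (linearMap_eq_on_homogeneous (ψ := 0) (fun a => ?_) hf)
  exact eq_zero_of_linForm_pow j φ
    (fun v hv => hle (Submodule.subset_span ⟨v, hv, rfl⟩)) a

theorem exists_GL_col {N : ℕ} (j : Fin N) (v : Fin N → ℂ) (hv : v j ≠ 0) :
    ∃ g : GL (Fin N) ℂ, ∀ i, (g : Matrix (Fin N) (Fin N) ℂ) i j = v i := by
  have hdet : ((1 : Matrix (Fin N) (Fin N) ℂ).updateCol j v).det ≠ 0 := by
    rw [← Matrix.cramer_apply, Matrix.cramer_one]
    exact hv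
  exact ⟨Matrix.GeneralLinearGroup.mkOfDetNeZero _ hdet, fun i => Matrix.updateCol_self⟩

theorem exists_GL_row {N : ℕ} (j : Fin N) (v : Fin N → ℂ) (hv : v j ≠ 0) :
    ∃ g : GL (Fin N) ℂ, ∀ i, (g : Matrix (Fin N) (Fin N) ℂ) j i = v i := by
  have hdet : ((1 : Matrix (Fin N) (Fin N) ℂ).updateRow j v).det ≠ 0 := by
    rw [← Matrix.cramer_transpose_apply, Matrix.transpose_one, Matrix.cramer_one]
    exact hv
  refine ⟨Matrix.GeneralLinearGroup.mkOfDetNeZero _ hdet, fun i => ?_⟩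
  exact congrFun (Matrix.updateRow_self (M := (1 : Matrix (Fin N) (Fin N) ℂ))) i

/-! ### The irreducible representations as functions on the general linear group -/

theorem det_ne_zero {N : ℕ} (g : GL (Fin N) ℂ) : (g : Matrix (Fin N) (Fin N) ℂ).det ≠ 0 :=
  ((Matrix.isUnit_iff_isUnit_det _).mp g.isUnit).ne_zero

theorem leadingMinor_last {n : ℕ} (x : GL (Fin (n + 1)) ℂ) :
    leadingMinor (Fin.last n) x = x.1.det := by
  let e : {i : Fin (n + 1) // i ≤ Fin.last n} ≃ Fin (n + 1) :=
    Equiv.subtypeUnivEquiv fun i => Fin.le_last i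
  exact Matrix.det_submatrix_equiv_self e x.1

theorem leadingMinor_penultimate {n : ℕ} (x : GL (Fin (n + 2)) ℂ) :
    leadingMinor (Fin.last n).castSucc x =
      x.1.adjugate (Fin.last (n + 1)) (Fin.last (n + 1)) := by
  let e : Fin (n + 1) ≃ {i : Fin (n + 2) // i ≤ (Fin.last n).castSucc} :=
    { toFun := fun i => ⟨i.castSucc, Fin.castSucc_le_castSucc_iff.mpr (Fin.le_last i)⟩
      invFun := fun i => ⟨i.1, Nat.lt_succ_of_le i.2⟩
      left_inv := fun i => rfl
      right_inv := fun i => rfl }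
  rw [Matrix.adjugate_fin_succ_eq_det_submatrix, ← two_mul, pow_mul, neg_one_sq, one_pow, one_mul,
    leadingMinor, ← Matrix.det_submatrix_equiv_self e, Matrix.submatrix_submatrix]
  congr 1
  ext i j
  simp [e, Fin.succAbove_last]

/-- The last diagonal entry of `x⁻¹` is the quotient of the last two leading minors of `x`. -/
theorem highestWeightFn_locCohWeight {n : ℕ} (d : ℕ) (x : GL (Fin (n + 1)) ℂ) :
    highestWeightFn (locCohWeight (n + 1) d) x = x.1.det⁻¹ *
      (x⁻¹).1 (Fin.last n) (Fin.last n) ^ d := by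
  have hdet := det_ne_zero x
  have hinv : (x⁻¹).1 (Fin.last n) (Fin.last n) =
      x.1.det⁻¹ * x.1.adjugate (Fin.last n) (Fin.last n) := by
    rw [Matrix.coe_units_inv, Matrix.inv_def, Ring.inverse_eq_inv, Matrix.smul_apply, smul_eq_mul]
  have hlow : ∏ l : Fin n, leadingMinor l.castSucc x ^
      ((locCohWeight (n + 1) d).1 l.castSucc - if h : (l.castSucc : ℕ) + 1 < n + 1 then
        (locCohWeight (n + 1) d).1 ⟨l.castSucc + 1, h⟩ else 0) =
      x.1.adjugate (Fin.last n) (Fin.last n) ^ d := by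
    rcases n with _ | n
    · rw [Finset.univ_eq_empty, Finset.prod_empty, Matrix.adjugate_fin_one, Matrix.one_apply_eq,
        one_pow]
    · rw [Fin.prod_univ_castSucc, Finset.prod_eq_one, one_mul, leadingMinor_penultimate]
      · have : ((locCohWeight (n + 1 + 1) d).1 (Fin.last n).castSucc -
            if h : ((Fin.last n).castSucc : ℕ) + 1 < n + 1 + 1 then
              (locCohWeight (n + 1 + 1) d).1 ⟨(Fin.last n).castSucc + 1, h⟩ else 0) = (d : ℤ) := by
          simp only [locCohWeight, Fin.val_castSucc, Fin.val_last]
          split_ifs <;> lia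
        rw [this, zpow_natCast]
      · intro l _
        have : ((locCohWeight (n + 1 + 1) d).1 l.castSucc.castSucc -
            if h : (l.castSucc.castSucc : ℕ) + 1 < n + 1 + 1 then
              (locCohWeight (n + 1 + 1) d).1 ⟨l.castSucc.castSucc + 1, h⟩ else 0) = 0 := by
          have := l.2
          simp only [locCohWeight, Fin.val_castSucc]
          split_ifs <;> lia
        rw [this, zpow_zero]
  have hlast : ((locCohWeight (n + 1) d).1 (Fin.last n) -
      if h : (Fin.last n : ℕ) + 1 < n + 1 then
        (locCohWeight (n + 1) d).1 ⟨Fin.last n + 1, h⟩ else 0) = -(d : ℤ) - 1 := by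
    simp [locCohWeight]
  rw [highestWeightFn, Fin.prod_univ_castSucc, hlow, hlast, leadingMinor_last, hinv, mul_pow,
    zpow_sub₀ hdet, zpow_neg, zpow_natCast, zpow_one, inv_pow]
  field_simp

/-- The function `x ↦ det(x)⁻¹ f(y)` on `GL_N(ℂ)`, where `y` is the last column of `x⁻¹`. -/
def polyFn {n : ℕ} : Poly (n + 1) →ₗ[ℂ] (GL (Fin (n + 1)) ℂ → ℂ) where
  toFun f x := x.1.det⁻¹ * MvPolynomial.eval
    (fun i => (x⁻¹).1 i (Fin.last n)) f
  map_add' f f' := by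
    ext x
    simp only [map_add, mul_add, Pi.add_apply]
  map_smul' c f := by
    ext x
    simp only [MvPolynomial.smul_eval, RingHom.id_apply, Pi.smul_apply, smul_eq_mul]
    ring

theorem rightTranslation_highestWeightFn {n d : ℕ} (g : GL (Fin (n + 1)) ℂ) :
    rightTranslation (n + 1) g (highestWeightFn (locCohWeight (n + 1) d)) =
      g.1.det⁻¹ • polyFn
        (linForm (fun i => (g⁻¹).1 (Fin.last n) i) ^ d) := by
  ext x
  change highestWeightFn (locCohWeight (n + 1) d) (x * g) = _ * (_ * MvPolynomial.eval _ _)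
  rw [highestWeightFn_locCohWeight, map_pow, eval_linForm, mul_inv_rev, Units.val_mul,
    Units.val_mul, Matrix.det_mul, mul_inv, Matrix.mul_apply]
  ring

theorem polyFn_mem_schur {n d : ℕ} {f : Poly (n + 1)} (hf : f.IsHomogeneous d) :
    polyFn f ∈ schur (locCohWeight (n + 1) d) := by
  have hle : Submodule.span ℂ {p : Poly (n + 1) | ∃ v : Fin (n + 1) → ℂ, v (Fin.last n) ≠ 0 ∧
      linForm v ^ d = p} ≤ (schur (locCohWeight (n + 1) d)).comap polyFn := by
    refine Submodule.span_le.mpr ?_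
    rintro _ ⟨v, hv, rfl⟩
    obtain ⟨g, hg⟩ := exists_GL_row (Fin.last n) v hv
    have h1 : rightTranslation (n + 1) g⁻¹ (highestWeightFn (locCohWeight (n + 1) d)) ∈
        schur (locCohWeight (n + 1) d) := Submodule.subset_span ⟨g⁻¹, rfl⟩
    rw [rightTranslation_highestWeightFn, inv_inv, funext hg] at h1
    exact (Submodule.smul_mem_iff (schur _) (inv_ne_zero (det_ne_zero g⁻¹))).mp h1
  exact hle (mem_span_linForm_pow (Fin.last n) hf)

/-! ### Weight spaces as irreducible representations -/

/-- The matrix coefficient `x ↦ ⟨x h, X_N ^ d⟩` of a class `h` in `Ext^N_S(S / 𝔪 ^ (d + 1), S)`, for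
the pairing of such classes with polynomials of degree `d`. -/
def matrixCoeff (n d : ℕ) : ExtPow (n + 1) (n + 1) (d + 1) →ₗ[ℂ] (GL (Fin (n + 1)) ℂ → ℂ) where
  toFun h x := pairing d (extAct (n + 1) (n + 1) (d + 1) x h) (MvPolynomial.X (Fin.last n) ^ d)
  map_add' h h' := by
    ext x
    simp only [map_add, LinearMap.add_apply, Pi.add_apply]
  map_smul' c h := by
    ext x
    simp only [map_smul, LinearMap.smul_apply, RingHom.id_apply, Pi.smul_apply]

theorem matrixCoeff_extAct {n d : ℕ} (g x : GL (Fin (n + 1)) ℂ)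
    (h : ExtPow (n + 1) (n + 1) (d + 1)) :
    matrixCoeff n d (extAct (n + 1) (n + 1) (d + 1) g h) x = matrixCoeff n d h (x * g) := by
  change pairing d (extAct _ _ _ x (extAct _ _ _ g h)) _ = pairing d (extAct _ _ _ (x * g) h) _
  rw [extAct_mul]

theorem matrixCoeff_apply {n d : ℕ} (h : ExtPow (n + 1) (n + 1) (d + 1))
    (x : GL (Fin (n + 1)) ℂ) :
    matrixCoeff n d h x = x.1.det⁻¹ * pairing d h
      (linForm (fun i => (x⁻¹).1 i (Fin.last n)) ^ d) := by
  have hX : (MvPolynomial.X (Fin.last n) ^ d : Poly (n + 1)).IsHomogeneous d := by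
    simpa using (MvPolynomial.isHomogeneous_X ℂ (Fin.last n)).pow d
  change pairing d (extAct _ _ _ x h) _ = _
  rw [pairing_extAct x h hX, map_pow, coordChange_X]

theorem matrixCoeff_eq_polyFn {n d : ℕ} (h : ExtPow (n + 1) (n + 1) (d + 1)) :
    matrixCoeff n d h = polyFn (powPoly d (pairing d h)) := by
  ext x
  rw [matrixCoeff_apply, ← eval_powPoly]
  rfl

theorem matrixCoeff_mem_schur {n d : ℕ} (h : ExtPow (n + 1) (n + 1) (d + 1)) :
    matrixCoeff n d h ∈ schur (locCohWeight (n + 1) d) := by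
  rw [matrixCoeff_eq_polyFn]
  exact polyFn_mem_schur (powPoly_isHomogeneous d _)

theorem pairing_eq_zero_of_matrixCoeff_eq_zero {n d : ℕ} {h : ExtPow (n + 1) (n + 1) (d + 1)}
    (h0 : matrixCoeff n d h = 0) (a : DegExp (n + 1) d) :
    pairing d h (MvPolynomial.monomial a.1 1) = 0 := by
  refine eq_zero_of_linForm_pow (Fin.last n) _ (fun v hv => ?_) a
  obtain ⟨g, hg⟩ := exists_GL_col (Fin.last n) v hv
  have h1 := congrFun h0 g⁻¹
  rw [matrixCoeff_apply, inv_inv, funext hg] at h1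
  exact (mul_eq_zero.mp h1).resolve_left (inv_ne_zero (det_ne_zero g⁻¹))

/-- The translate of the highest weight function by `g` is the matrix coefficient of a class whose
pairing with polynomials is a multiple of the evaluation at the last row of `g⁻¹`. -/
theorem schur_le_range_matrixCoeff (n d : ℕ) :
    schur (locCohWeight (n + 1) d) ≤ LinearMap.range (matrixCoeff n d) := by
  refine Submodule.span_le.mpr ?_
  rintro _ ⟨g, rfl⟩
  let r : Fin (n + 1) → ℂ :=
    fun i => (g⁻¹).1 (Fin.last n) i
  let φ : Poly (n + 1) →ₗ[ℂ] ℂ :=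
    g.1.det⁻¹ • (MvPolynomial.aeval (R := ℂ) r).toLinearMap
  obtain ⟨h, hh⟩ := exists_pairing_eq fun a : DegExp (n + 1) d => φ (MvPolynomial.monomial a.1 1)
  refine ⟨h, ?_⟩
  dsimp only
  rw [rightTranslation_highestWeightFn]
  ext x
  rw [matrixCoeff_apply, linearMap_eq_on_homogeneous hh (linForm_pow_isHomogeneous _ d)]
  change x.1.det⁻¹ * (g.1.det⁻¹ * MvPolynomial.eval r _) =
    g.1.det⁻¹ * (x.1.det⁻¹ * MvPolynomial.eval _ _)
  rw [map_pow, map_pow, eval_linForm, eval_linForm, mul_left_comm]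
  simp only [r, mul_comm]

/-! ### Graded modules -/

namespace GrMod

variable {N : ℕ} (X : GrMod N)

/-- The additive map on a graded module with prescribed restrictions to the graded pieces. -/
def lift {M : Type*} [AddCommGroup M] (φ : ∀ k, X.piece k →+ M) : X.carrier →+ M :=
  (DirectSum.toAddMonoid φ).comp
    (AddEquiv.ofBijective (DirectSum.coeAddMonoidHom X.piece) X.isInternal).symm.toAddMonoidHom

theorem lift_of_mem {M : Type*} [AddCommGroup M] (φ : ∀ k, X.piece k →+ M) {k : ℤ} {x : X.carrier}
    (hx : x ∈ X.piece k) : X.lift φ x = φ k ⟨x, hx⟩ := by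
  have h : (AddEquiv.ofBijective (DirectSum.coeAddMonoidHom X.piece) X.isInternal).symm x =
      DirectSum.of (fun k => X.piece k) k ⟨x, hx⟩ := by
    rw [AddEquiv.symm_apply_eq]
    exact (DirectSum.coeAddMonoidHom_of X.piece k ⟨x, hx⟩).symm
  change DirectSum.toAddMonoid φ ((AddEquiv.ofBijective _ X.isInternal).symm x) = _
  rw [h, DirectSum.toAddMonoid_of]

theorem induction {p : X.carrier → Prop} (hadd : ∀ x y, p x → p y → p (x + y))
    (hmem : ∀ k, ∀ x ∈ X.piece k, p x) (x : X.carrier) : p x := by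
  obtain ⟨y, rfl⟩ := X.isInternal.2 x
  induction y using DirectSum.induction_on with
  | zero => rw [map_zero]; exact hmem 0 0 (zero_mem _)
  | of k y => rw [DirectSum.coeAddMonoidHom_of]; exact hmem k _ y.2
  | add y z hy hz => rw [map_add]; exact hadd _ _ hy hz

/-- The projection of a graded module to its piece of degree `k`. -/
def proj (k : ℤ) : X.carrier →+ X.carrier :=
  X.lift fun l => if k = l then (X.piece l).subtype else 0

theorem proj_of_mem {k l : ℤ} {x : X.carrier} (hx : x ∈ X.piece l) :
    X.proj k x = if k = l then x else 0 := by
  rw [proj, X.lift_of_mem _ hx]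
  split_ifs <;> rfl

theorem proj_mem (k : ℤ) (x : X.carrier) : X.proj k x ∈ X.piece k := by
  induction x using X.induction with
  | hadd x y hx hy => rw [map_add]; exact add_mem hx hy
  | hmem l x hx =>
    rw [X.proj_of_mem hx]
    split_ifs with h
    · exact h ▸ hx
    · exact zero_mem _

theorem exists_sum_proj (x : X.carrier) :
    ∃ s : Finset ℤ, ∀ t, s ⊆ t → ∑ k ∈ t, X.proj k x = x := by
  classical
  induction x using X.induction with
  | hadd x y hx hy =>
    obtain ⟨s, hs⟩ := hx
    obtain ⟨s', hs'⟩ := hy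
    refine ⟨s ∪ s', fun t ht => ?_⟩
    simp_rw [map_add]
    rw [Finset.sum_add_distrib, hs t (Finset.union_subset_left ht),
      hs' t (Finset.union_subset_right ht)]
  | hmem l x hx =>
    refine ⟨{l}, fun t ht => ?_⟩
    simp_rw [X.proj_of_mem hx]
    rw [Finset.sum_ite_eq', if_pos (ht (Finset.mem_singleton_self l))]

end GrMod

theorem isInternal_of_proj {M : Type*} [AddCommGroup M] (A : ℤ → AddSubgroup M)
    (π : ℤ → M →+ M) (hmem : ∀ k x, π k x ∈ A k)
    (hπ : ∀ k l x, x ∈ A l → π k x = if k = l then x else 0)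
    (hsum : ∀ x, ∃ s : Finset ℤ, ∑ k ∈ s, π k x = x) : DirectSum.IsInternal A := by
  constructor
  · refine (injective_iff_map_eq_zero _).mpr fun x hx => ?_
    have key : ∀ y : ⨁ k, A k, ∀ k, π k (DirectSum.coeAddMonoidHom A y) = y k := by
      intro y k
      induction y using DirectSum.induction_on with
      | zero => rw [map_zero, map_zero]; rfl
      | of l y =>
        rw [DirectSum.coeAddMonoidHom_of, hπ k l _ y.2]
        split_ifs with h
        · subst h
          rw [DirectSum.of_eq_same]
        · rw [DirectSum.of_eq_of_ne _ _ _ h]; rfl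
      | add y z hy hz => rw [map_add, map_add, hy, hz]; rfl
    refine DFinsupp.ext fun k => Subtype.ext ?_
    rw [← key x k, hx, map_zero]
    rfl
  · intro x
    obtain ⟨s, hs⟩ := hsum x
    refine ⟨∑ k ∈ s, DirectSum.of (fun k => A k) k ⟨π k x, hmem k x⟩, ?_⟩
    rw [map_sum]
    simp only [DirectSum.coeAddMonoidHom_of]
    exact hs

theorem eq_zero_or_isHomogeneous {N : ℕ} {k : ℤ} {f : Poly N} (hf : f ∈ polyPiece N k) :
    f = 0 ∨ ∃ a : ℕ, k = a ∧ f.IsHomogeneous a := by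
  by_cases hk : k < 0
  · left
    ext e
    by_contra h
    have := hf e h
    lia
  · right
    obtain ⟨a, rfl⟩ := Int.eq_ofNat_of_zero_le (not_lt.mp hk)
    refine ⟨a, rfl, fun e he => ?_⟩
    have h : e.degree = a := by exact_mod_cast hf e he
    rwa [Finsupp.degree_eq_weight_one] at h

theorem poly_induction {N : ℕ} {p : Poly N → Prop} (h0 : p 0)
    (hadd : ∀ f h, p f → p h → p (f + h))
    (hom : ∀ (a : ℕ) (f : Poly N), f.IsHomogeneous a → p f) (f : Poly N) : p f := by
  refine (grSelf N).induction hadd (fun k f hf => ?_) f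
  rcases eq_zero_or_isHomogeneous hf with rfl | ⟨a, -, ha⟩
  · exact h0
  · exact hom a f ha

/-! ### Homogeneous classes are eigenvectors of the dilation -/

/-- The inverse of the dilation by two on a graded module: multiplication by `2 ^ (-k)` on the piece
of degree `k`. -/
def GrMod.dilInv {N : ℕ} (X : GrMod N) : X.carrier →+ X.carrier :=
  X.lift fun k => (DistribSMul.toAddMonoidHom X.carrier
    (MvPolynomial.C ((2 : ℂ) ^ (-k)) : Poly N)).comp (X.piece k).subtype

theorem GrMod.dilInv_of_mem {N : ℕ} (X : GrMod N) {k : ℤ} {x : X.carrier} (hx : x ∈ X.piece k) :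
    X.dilInv x = (MvPolynomial.C ((2 : ℂ) ^ (-k)) : Poly N) • x := by
  rw [GrMod.dilInv, X.lift_of_mem _ hx]
  rfl

theorem GrMod.dilInv_smul {N : ℕ} (X : GrMod N) (f : Poly N) (x : X.carrier) :
    X.dilInv (f • x) = coordChange (dilation N)⁻¹ f • X.dilInv x := by
  induction x using X.induction with
  | hadd x y hx hy => rw [smul_add, map_add, hx, hy, map_add, smul_add]
  | hmem k x hx =>
    induction f using poly_induction with
    | h0 => rw [zero_smul, map_zero, map_zero, zero_smul]
    | hadd f h hf hh => rw [add_smul, map_add, hf, hh, map_add, add_smul]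
    | hom a f hf =>
      rw [X.dilInv_of_mem hx, X.dilInv_of_mem (X.smul_mem a f hf k x hx),
        coordChange_dilation_inv hf, smul_smul, smul_smul, MvPolynomial.smul_eq_C_mul,
        mul_right_comm, ← map_mul]
      congr 3
      rw [neg_add, zpow_add₀ two_ne_zero, zpow_neg, zpow_natCast, inv_pow]

/-- The map `GrMod.dilInv` as a linear map to the twisted module. -/
def GrMod.dilHom {N : ℕ} (X : GrMod N) : X.carrier ⟶ (twist (dilation N)).obj X.carrier :=
  ModuleCat.ofHom (Y := (twist (dilation N)).obj X.carrier)
    { toFun := X.dilInv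
      map_add' := map_add _
      map_smul' := X.dilInv_smul }

theorem dilHom_comp {N : ℕ} {X Y : GrMod N} (f : X.carrier ⟶ Y.carrier)
    (hf : IsHomogeneousHom X Y f 0) :
    X.dilHom ≫ (twist (dilation N)).map f = f ≫ Y.dilHom := by
  refine ModuleCat.hom_ext (LinearMap.ext fun x => ?_)
  change f.hom (X.dilInv x) = Y.dilInv (f.hom x)
  induction x using X.induction with
  | hadd x y hx hy => rw [map_add, map_add, hx, hy, map_add, map_add]
  | hmem k x hx =>
    have h1 := hf k x hx
    rw [add_zero] at h1
    rw [X.dilInv_of_mem hx, Y.dilInv_of_mem h1, map_smul]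

theorem coordChange_dilation {N : ℕ} {k : ℤ} {f : Poly N} (hf : f ∈ polyPiece N k) :
    coordChange (dilation N) f = MvPolynomial.C ((2 : ℂ) ^ k) * f := by
  rcases eq_zero_or_isHomogeneous hf with rfl | ⟨a, rfl, ha⟩
  · rw [map_zero, mul_zero]
  · have h1 := congrArg (coordChange (dilation N)) (coordChange_dilation_inv ha)
    rw [coordChange_inv_apply, map_smul] at h1
    conv_rhs => rw [h1]
    rw [← MvPolynomial.smul_eq_C_mul, smul_smul, zpow_natCast, ← mul_pow,
      mul_inv_cancel₀ two_ne_zero, one_pow, one_smul]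

theorem twistAct_dilHom_mk₀ {N : ℕ} {k : ℤ} {X : GrMod N} (f : X.carrier ⟶ polyMod N)
    (hf : IsHomogeneousHom X (grSelf N) f k) :
    twistAct (dilation N) X.dilHom 0 (Abelian.Ext.mk₀ f) =
      (2 : ℂ) ^ k • Abelian.Ext.mk₀ f := by
  rw [twistAct_mk₀, ← C_smul_ext, ← Abelian.Ext.mk₀_smul]
  refine congrArg _ (ModuleCat.hom_ext (LinearMap.ext fun x => ?_))
  change coordChange (dilation N) (f.hom (X.dilInv x)) =
    MvPolynomial.C ((2 : ℂ) ^ k) * (f.hom x : Poly N)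
  induction x using X.induction with
  | hadd x y hx hy => rw [map_add, map_add, map_add, map_add, hx, hy, mul_add]
  | hmem l x hx =>
    have h1 : f.hom x ∈ polyPiece N (l + k) := hf l x hx
    rw [X.dilInv_of_mem hx, map_smul, smul_eq_mul, map_mul, coordChange_dilation h1,
      MvPolynomial.algHom_C, MvPolynomial.algebraMap_eq, ← mul_assoc, ← map_mul]
    congr 2
    rw [← zpow_add₀ two_ne_zero, neg_add_cancel_left]

theorem twistAct_dilHom {N n : ℕ} {k : ℤ} {X : GrMod N}
    {x : Abelian.Ext.{0} X.carrier (polyMod N) n}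
    (hx : IsHomogeneousExt (grSelf N) k n X x) :
    twistAct (dilation N) X.dilHom n x = (2 : ℂ) ^ k • x := by
  induction n generalizing X with
  | zero =>
    obtain ⟨f, hf, rfl⟩ := hx
    exact twistAct_dilHom_mk₀ f hf
  | succ n ih =>
    obtain ⟨K, P, i, p, w, hs, y, hi, hp, hy, rfl⟩ := hx
    refine (twistAct_extClass (dilation N) hs (dilHom_comp i hi) (dilHom_comp p hp)
      (add_comm 1 n) y).trans ?_
    rw [ih hy]
    exact Abelian.Ext.comp_smul _ _ _ _

theorem quotAct_dilation (N d : ℕ) : quotAct (dilation N) d = (grQuot N d).dilHom := by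
  refine ModuleCat.hom_ext (LinearMap.ext fun x => ?_)
  change (quotAct (dilation N) d).hom x = (grQuot N d).dilInv x
  induction x using (grQuot N d).induction with
  | hadd x y hx hy =>
    rw [map_add, ← hx, ← hy]
    exact map_add (quotAct (dilation N) d).hom _ _
  | hmem k x hx =>
    rw [(grQuot N d).dilInv_of_mem hx]
    obtain ⟨f, hf, rfl⟩ := hx
    refine congrArg (Ideal.Quotient.mk (maxIdeal N ^ d))
      (?_ : coordChange (dilation N)⁻¹ f = MvPolynomial.C ((2 : ℂ) ^ (-k)) * f)
    rcases eq_zero_or_isHomogeneous hf with rfl | ⟨a, rfl, ha⟩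
    · rw [map_zero, mul_zero]
    · rw [coordChange_dilation_inv ha, MvPolynomial.smul_eq_C_mul, zpow_neg, zpow_natCast, inv_pow]

/-- A homogeneous class of degree `k` is an eigenvector of the dilation by two, of eigenvalue
`2 ^ k`. -/
theorem extAct_dilation_of_isHomogeneousExt {N n d : ℕ} {k : ℤ} {x : ExtPow N n d}
    (hx : IsHomogeneousExt (grSelf N) k n (grQuot N d) x) :
    extAct N n d (dilation N) x = (2 : ℂ) ^ k • x := by
  rw [extAct_eq_twistAct, quotAct_dilation]
  exact twistAct_dilHom hx

/-! ### Decomposition of extension classes into homogeneous classes -/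

/-- The component of degree `k` of a homomorphism `f` of graded modules, as an additive map: it
sends `x` of degree `l` to the component of degree `l + k` of `f x`. -/
def homComponentAux {N : ℕ} {X Y : GrMod N} (f : X.carrier ⟶ Y.carrier) (k : ℤ) :
    X.carrier →+ Y.carrier :=
  X.lift fun l => ((Y.proj (l + k)).comp f.hom.toAddMonoidHom).comp (X.piece l).subtype

theorem homComponentAux_of_mem {N : ℕ} {X Y : GrMod N} (f : X.carrier ⟶ Y.carrier) {k l : ℤ}
    {x : X.carrier} (hx : x ∈ X.piece l) :
    homComponentAux f k x = Y.proj (l + k) (f.hom x) := by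
  rw [homComponentAux, X.lift_of_mem _ hx]
  rfl

theorem GrMod.proj_smul {N : ℕ} (X : GrMod N) {a : ℕ} {f : Poly N} (hf : f.IsHomogeneous a)
    (k : ℤ) (x : X.carrier) : X.proj (a + k) (f • x) = f • X.proj k x := by
  induction x using X.induction with
  | hadd x y hx hy => rw [smul_add, map_add, hx, hy, map_add, smul_add]
  | hmem l x hx =>
    rw [X.proj_of_mem hx, X.proj_of_mem (X.smul_mem a f hf l x hx)]
    by_cases h : k = l
    · rw [if_pos h, if_pos (by rw [h])]
    · rw [if_neg h, if_neg (by lia), smul_zero]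

theorem homComponentAux_smul {N : ℕ} {X Y : GrMod N} (f : X.carrier ⟶ Y.carrier) (k : ℤ)
    (s : Poly N) (x : X.carrier) :
    homComponentAux f k (s • x) = s • homComponentAux f k x := by
  induction x using X.induction with
  | hadd x y hx hy => rw [smul_add, map_add, hx, hy, map_add, smul_add]
  | hmem l x hx =>
    induction s using poly_induction with
    | h0 => rw [zero_smul, map_zero, zero_smul]
    | hadd s t hs ht => rw [add_smul, map_add, hs, ht, add_smul]
    | hom a s hs =>
      rw [homComponentAux_of_mem f hx, homComponentAux_of_mem f (X.smul_mem a s hs l x hx),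
        map_smul, add_assoc, Y.proj_smul hs]

/-- The component of degree `k` of a homomorphism of graded modules. -/
def homComponent {N : ℕ} {X Y : GrMod N} (f : X.carrier ⟶ Y.carrier) (k : ℤ) :
    X.carrier ⟶ Y.carrier :=
  ModuleCat.ofHom
    { toFun := homComponentAux f k
      map_add' := map_add _
      map_smul' := homComponentAux_smul f k }

theorem homComponent_isHomogeneousHom {N : ℕ} {X Y : GrMod N} (f : X.carrier ⟶ Y.carrier)
    (k : ℤ) : IsHomogeneousHom X Y (homComponent f k) k := by
  intro l x hx
  change homComponentAux f k x ∈ _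
  rw [homComponentAux_of_mem f hx]
  exact Y.proj_mem _ _

theorem GrMod.exists_finset_homogeneous {N : ℕ} (X : GrMod N)
    [Module.Finite (Poly N) X.carrier] :
    ∃ T : Finset X.carrier, (∀ x ∈ T, ∃ k, x ∈ X.piece k) ∧
      Submodule.span (Poly N) (T : Set X.carrier) = ⊤ := by
  classical
  obtain ⟨S, hS⟩ := Module.Finite.fg_top (R := Poly N) (M := X.carrier)
  choose s hs using X.exists_sum_proj
  refine ⟨S.biUnion fun x => (s x).image fun k => X.proj k x, ?_, ?_⟩
  · intro x hx
    simp only [Finset.mem_biUnion, Finset.mem_image] at hx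
    obtain ⟨y, -, k, -, rfl⟩ := hx
    exact ⟨k, X.proj_mem k y⟩
  · rw [eq_top_iff, ← hS, Submodule.span_le]
    intro x hx
    rw [SetLike.mem_coe, ← hs x (s x) subset_rfl]
    refine Submodule.sum_mem _ fun k hk => Submodule.subset_span ?_
    simp only [Finset.coe_biUnion, Set.mem_iUnion, Finset.mem_coe]
    exact ⟨x, hx, Finset.mem_image_of_mem _ hk⟩

theorem exists_eq_sum_homComponent {N : ℕ} {X Y : GrMod N} [Module.Finite (Poly N) X.carrier]
    (f : X.carrier ⟶ Y.carrier) : ∃ s : Finset ℤ, f = ∑ k ∈ s, homComponent f k := by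
  classical
  obtain ⟨T, hT, hspan⟩ := X.exists_finset_homogeneous
  choose s hs using Y.exists_sum_proj
  choose! d hd using hT
  refine ⟨T.biUnion fun x => (s (f.hom x)).image fun k => k - d x, ?_⟩
  refine ModuleCat.hom_ext (LinearMap.ext_on hspan fun x hx => ?_)
  rw [ModuleCat.hom_sum, LinearMap.sum_apply]
  change _ = ∑ k ∈ _, homComponentAux f k x
  simp_rw [homComponentAux_of_mem f (hd x hx)]
  rw [← Finset.sum_image (f := fun k => Y.proj k (f.hom x)) (g := fun k => d x + k)
    (fun a _ b _ h => add_left_cancel h), hs]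
  intro k hk
  simp only [Finset.mem_image, Finset.mem_biUnion]
  exact ⟨k - d x, ⟨x, hx, k, hk, rfl⟩, by ring⟩

/-- The projection of `S` to its piece of degree `k`. -/
def polyProj {N : ℕ} (k : ℤ) : Poly N →+ Poly N := (grSelf N).proj k

theorem polyProj_mem {N : ℕ} (k : ℤ) (f : Poly N) : polyProj k f ∈ polyPiece N k :=
  (grSelf N).proj_mem k f

theorem polyProj_of_mem {N : ℕ} {k l : ℤ} {f : Poly N} (hf : f ∈ polyPiece N l) :
    polyProj k f = if k = l then f else 0 :=
  (grSelf N).proj_of_mem hf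

theorem exists_sum_polyProj {N : ℕ} (f : Poly N) :
    ∃ s : Finset ℤ, ∀ t, s ⊆ t → ∑ k ∈ t, polyProj k f = f :=
  (grSelf N).exists_sum_proj f

/-- The free module on generators of prescribed degrees. -/
def grFree {N : ℕ} {ι : Type} [Finite ι] (d : ι → ℤ) : GrMod N where
  carrier := ModuleCat.of (Poly N) (ι → Poly N)
  piece k :=
    { carrier := {v | ∀ i, v i ∈ polyPiece N (k - d i)}
      zero_mem' := fun _ => zero_mem _
      add_mem' := fun hv hw i => add_mem (hv i) (hw i)
      neg_mem' := fun hv i => neg_mem (hv i) }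
  isInternal := by
    classical
    refine isInternal_of_proj (M := ι → Poly N) _
      (fun k => { toFun := fun v i => polyProj (k - d i) (v i)
                  map_zero' := funext fun i => map_zero _
                  map_add' := fun v w => funext fun i => map_add _ _ _ }) ?_ ?_ ?_
    · exact fun k v i => polyProj_mem _ _
    · intro k l v hv
      funext i
      refine (polyProj_of_mem (hv i)).trans ?_
      by_cases h : k = l
      · rw [if_pos h, if_pos (by rw [h])]
      · rw [if_neg h, if_neg (by lia)]; rfl
    · intro v
      have := Fintype.ofFinite ι
      choose s hs using exists_sum_polyProj (N := N)
      refine ⟨Finset.univ.biUnion fun i => (s (v i)).image fun k => k + d i, ?_⟩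
      funext i
      rw [Finset.sum_apply]
      change ∑ k ∈ _, polyProj (k - d i) (v i) = v i
      rw [← Finset.sum_image (f := fun k => polyProj k (v i)) (g := fun k => k - d i)
        (fun a _ b _ h => sub_left_injective h), hs]
      intro k hk
      simp only [Finset.mem_image, Finset.mem_biUnion]
      exact ⟨k + d i, ⟨i, Finset.mem_univ i, k, hk, rfl⟩, by ring⟩
  smul_mem a f hf k v hv i := by
    have := polyPiece_mul_mem hf (hv i)
    rwa [← add_sub_assoc] at this

/-- The kernel of a homomorphism of degree `0`. -/
def grKer {N : ℕ} {P X : GrMod N} (p : P.carrier ⟶ X.carrier) (hp : IsHomogeneousHom P X p 0) :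
    GrMod N where
  carrier := ModuleCat.of (Poly N) (LinearMap.ker p.hom)
  piece k := (P.piece k).comap (LinearMap.ker p.hom).subtype.toAddMonoidHom
  isInternal := by
    have hcomm : ∀ k x, p.hom (P.proj k x) = X.proj k (p.hom x) := by
      intro k x
      induction x using P.induction with
      | hadd x y hx hy => rw [map_add, map_add, hx, hy, map_add, map_add]
      | hmem l x hx =>
        have h1 := hp l x hx
        rw [add_zero] at h1
        rw [P.proj_of_mem hx, X.proj_of_mem h1]
        split_ifs <;> simp
    refine isInternal_of_proj (M := LinearMap.ker p.hom) _
      (fun k => { toFun := fun v => ⟨P.proj k v.1, by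
                    rw [LinearMap.mem_ker, hcomm, v.2, map_zero]⟩
                  map_zero' := Subtype.ext (map_zero _)
                  map_add' := fun v w => Subtype.ext (map_add _ _ _) }) ?_ ?_ ?_
    · exact fun k v => P.proj_mem _ _
    · intro k l v hv
      refine Subtype.ext ((P.proj_of_mem (hv : v.1 ∈ P.piece l)).trans ?_)
      split_ifs <;> rfl
    · intro v
      obtain ⟨s, hs⟩ := P.exists_sum_proj v.1
      refine ⟨s, Subtype.ext ?_⟩
      rw [AddSubmonoidClass.coe_finsetSum]
      exact hs s subset_rfl
  smul_mem a f hf k v hv := P.smul_mem a f hf k v.1 hv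

/-- A finitely generated graded module is a quotient of a finitely generated free graded module. -/
theorem exists_graded_cover {N : ℕ} (X : GrMod N) [Module.Finite (Poly N) X.carrier] :
    ∃ (P : GrMod N) (p : P.carrier ⟶ X.carrier), IsHomogeneousHom P X p 0 ∧
      Function.Surjective p.hom ∧ Projective P.carrier ∧ Module.Finite (Poly N) P.carrier := by
  classical
  obtain ⟨T, hT, hspan⟩ := X.exists_finset_homogeneous
  choose d hd using fun x : T => hT x.1 x.2
  refine ⟨grFree d, ModuleCat.ofHom (Fintype.linearCombination (Poly N) fun x : T => x.1),
    ?_, ?_, ModuleCat.projective_of_free (Pi.basisFun (Poly N) T),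
    inferInstanceAs (Module.Finite (Poly N) (T → Poly N))⟩
  · intro l (v : T → Poly N) hv
    change Fintype.linearCombination (Poly N) (fun x : T => x.1) v ∈ X.piece (l + 0)
    rw [Fintype.linearCombination_apply, add_zero]
    refine sum_mem fun x _ => ?_
    rcases eq_zero_or_isHomogeneous (hv x) with h | ⟨a, ha, hom⟩
    · rw [h, zero_smul]
      exact zero_mem _
    · have := X.smul_mem a (v x) hom (d x) x.1 (hd x)
      rwa [← ha, sub_add_cancel] at this
  · change Function.Surjective (Fintype.linearCombination (Poly N) fun x : T => x.1)
    rw [← LinearMap.range_eq_top, Fintype.range_linearCombination,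
      show (Set.range fun x : T => x.1) = (T : Set X.carrier) from Subtype.range_coe]
    exact hspan

/-- Every class in `Ext^n_S(X, Y)`, for graded modules with `X` finitely generated, is a sum of
homogeneous classes: it comes by iterated connecting maps from a homomorphism on a syzygy in a
graded free resolution, and such a homomorphism is the sum of its finitely many components. -/
theorem mem_closure_isHomogeneousExt {N : ℕ} (Y : GrMod N) (n : ℕ) (X : GrMod N)
    [Module.Finite (Poly N) X.carrier] (x : Abelian.Ext.{0} X.carrier Y.carrier n) :
    x ∈ AddSubgroup.closure {x | ∃ k, IsHomogeneousExt Y k n X x} := by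
  induction n generalizing X with
  | zero =>
    obtain ⟨f, rfl⟩ := (Abelian.Ext.mk₀_bijective _ _).2 x
    obtain ⟨s, hs⟩ := exists_eq_sum_homComponent f
    rw [hs, ← Abelian.Ext.addEquiv₀_symm_apply, map_sum]
    refine sum_mem fun k _ => AddSubgroup.subset_closure ?_
    exact ⟨k, homComponent f k, homComponent_isHomogeneousHom f k, rfl⟩
  | succ n ih =>
    obtain ⟨P, p, hp, hsurj, _, hfin⟩ := exists_graded_cover X
    have hS : (LinearMap.shortComplexKer p.hom).ShortExact :=
      LinearMap.shortExact_shortComplexKer hsurj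
    obtain ⟨y, rfl⟩ := Abelian.Ext.contravariant_sequence_exact₃ hS Y.carrier x
      (Abelian.Ext.eq_zero_of_projective (P := P.carrier) _) (add_comm 1 n)
    have : Module.Finite (Poly N) (grKer p hp).carrier :=
      inferInstanceAs (Module.Finite (Poly N) (LinearMap.ker p.hom))
    have hy := ih (grKer p hp) y
    induction hy using AddSubgroup.closure_induction with
    | mem y hy =>
      obtain ⟨k, hk⟩ := hy
      refine AddSubgroup.subset_closure ⟨k, grKer p hp, P, _, p, _, hS, y, ?_, hp, hk, rfl⟩
      intro l v hv
      rw [add_zero]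
      exact hv
    | zero =>
      erw [Abelian.Ext.comp_zero]
      exact zero_mem _
    | add y z _ _ hy hz =>
      erw [Abelian.Ext.comp_add]
      exact add_mem hy hz
    | neg y _ hy =>
      erw [Abelian.Ext.comp_neg]
      exact neg_mem hy

/-! ### Local cohomology as the direct sum of the weight spaces -/

/-- The weight space of degree `-d - N` is isomorphic to the irreducible representation of highest
weight `(-1, …, -1, -d - 1)`, by taking matrix coefficients. -/
def weightEquiv (n d : ℕ) : weightSpace (n + 1) d ≃ₗ[ℂ] schur (locCohWeight (n + 1) d) :=
  LinearEquiv.ofBijective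
    (((matrixCoeff n d).codRestrict _ matrixCoeff_mem_schur).comp (weightSpace (n + 1) d).subtype)
    (by
      constructor
      · refine (injective_iff_map_eq_zero _).mpr fun w hw => Subtype.ext ?_
        exact eq_zero_of_mem_weightSpace w.2
          (pairing_eq_zero_of_matrixCoeff_eq_zero (congrArg Subtype.val hw))
      · rintro ⟨f, hf⟩
        obtain ⟨h, rfl⟩ := schur_le_range_matrixCoeff n d hf
        obtain ⟨w, hw, u, rfl⟩ := exists_eq_add_transition h
        refine ⟨⟨w, hw⟩, Subtype.ext ?_⟩
        have hu : matrixCoeff n d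
            (extTransition (n + 1) (n + 1) d (d + 1) (Nat.le_succ d) u) = 0 := by
          ext x
          rw [matrixCoeff_apply, pairing_transition, LinearMap.zero_apply, mul_zero]
          rfl
        change matrixCoeff n d w = matrixCoeff n d (w + _)
        rw [map_add, hu, add_zero])

theorem quotPowProj_comp (N : ℕ) {d d' d'' : ℕ} (h : d ≤ d') (h' : d' ≤ d'') :
    quotPowProj N h' ≫ quotPowProj N h = quotPowProj N (h.trans h') := by
  refine ModuleCat.hom_ext (LinearMap.ext fun m => ?_)
  obtain ⟨m, rfl⟩ := Ideal.Quotient.mk_surjective m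
  rfl

instance (N j : ℕ) : DirectedSystem (ExtPow N j) fun d d' h => extTransition N j d d' h where
  map_self d z := by
    have : quotPowProj N (le_refl d) = 𝟙 (quotPow N d) := by
      refine ModuleCat.hom_ext (LinearMap.ext fun m => ?_)
      obtain ⟨m, rfl⟩ := Ideal.Quotient.mk_surjective m
      rfl
    rw [extTransition_apply, this, Abelian.Ext.mk₀_id_comp]
  map_map d d' d'' h h' z := by
    rw [extTransition_apply, extTransition_apply, extTransition_apply,
      Abelian.Ext.mk₀_comp_mk₀_assoc, quotPowProj_comp]

theorem extTransition_injective (N : ℕ) {d d' : ℕ} (h : d ≤ d') :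
    Function.Injective (extTransition N N d d' h) := by
  induction d', h using Nat.le_induction with
  | base =>
    intro x y hxy
    rwa [DirectedSystem.map_self' (f := fun d d' h => extTransition N N d d' h),
      DirectedSystem.map_self' (f := fun d d' h => extTransition N N d d' h)] at hxy
  | succ d' h ih =>
    intro x y hxy
    rw [← DirectedSystem.map_map' (f := fun d d' h => extTransition N N d d' h) h (Nat.le_succ d'),
      ← DirectedSystem.map_map' (f := fun d d' h => extTransition N N d d' h) h
        (Nat.le_succ d')] at hxy
    exact ih (extTransition_succ_injective N d' hxy)

theorem LocCoh.of_injective (N d : ℕ) : Function.Injective (LocCoh.of N N d) := by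
  refine (injective_iff_map_eq_zero _).mpr fun z hz => ?_
  obtain ⟨d', h, h0⟩ := Module.DirectLimit.of.zero_exact hz
  exact extTransition_injective N h (h0.trans (map_zero _).symm)

theorem LocCoh.of_transition (N j : ℕ) {d d' : ℕ} (h : d ≤ d') (z : ExtPow N j d) :
    LocCoh.of N j d' (extTransition N j d d' h z) = LocCoh.of N j d z :=
  Module.DirectLimit.of_f

theorem LocCoh.exists_of {N j : ℕ} (x : LocCoh N j) : ∃ d z, LocCoh.of N j d z = x :=
  Module.DirectLimit.exists_of x

theorem locCohAct_of {N j d : ℕ} (g : GL (Fin N) ℂ) (z : ExtPow N j d) :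
    locCohAct N j g (LocCoh.of N j d z) = LocCoh.of N j d (extAct N j d g z) :=
  Module.DirectLimit.map_apply_of _ _ _

theorem subsingleton_locCoh {N j : ℕ} (hj : j ≠ N) : Subsingleton (LocCoh N j) :=
  subsingleton_of_forall_eq 0 fun x => by
    obtain ⟨d, z, rfl⟩ := x.exists_of
    rw [extPow_eq_zero hj d z, map_zero]

/-- The sum map from the weight spaces to local cohomology. -/
def weightSum (N : ℕ) : (⨁ d, weightSpace N d) →ₗ[ℂ] LocCoh N N :=
  DirectSum.toModule ℂ ℕ _ fun d => (LocCoh.of N N (d + 1)).comp (weightSpace N d).subtype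

theorem weightSum_lof {N d : ℕ} (w : weightSpace N d) :
    weightSum N (DirectSum.lof ℂ ℕ (fun d => weightSpace N d) d w) =
      LocCoh.of N N (d + 1) w.1 := by
  rw [weightSum, DirectSum.toModule_lof]
  rfl

theorem weightSum_surjective (N : ℕ) : Function.Surjective (weightSum N) := by
  intro x
  obtain ⟨d, z, rfl⟩ := x.exists_of
  rw [← LinearMap.mem_range]
  induction d with
  | zero =>
    rw [(subsingleton_extPow_zero N N).elim z 0, map_zero]
    exact zero_mem _
  | succ d ih =>
    obtain ⟨w, hw, u, rfl⟩ := exists_eq_add_transition z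
    rw [map_add, LocCoh.of_transition]
    exact add_mem ⟨_, weightSum_lof ⟨w, hw⟩⟩ (ih u)

/-- Eigenspaces of the dilation for different eigenvalues are independent. -/
theorem weightSum_injective (N : ℕ) : Function.Injective (weightSum N) := by
  let V : ℕ → Submodule ℂ (LocCoh N N) := fun d =>
    Module.End.eigenspace (locCohAct N N (dilation N)) (dilationEigenvalue N d)
  have hV : iSupIndep V :=
    (Module.End.eigenspaces_iSupIndep (locCohAct N N (dilation N))).comp
      (dilationEigenvalue_injective N)
  let ι : ∀ d, weightSpace N d →ₗ[ℂ] V d := fun d =>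
    ((LocCoh.of N N (d + 1)).comp (weightSpace N d).subtype).codRestrict (V d) fun w => by
      rw [Module.End.mem_eigenspace_iff, LinearMap.comp_apply, locCohAct_of,
        Submodule.subtype_apply, mem_weightSpace.mp w.2, map_smul]
  have hι : ∀ d, Function.Injective (ι d) := fun d w w' h =>
    Subtype.ext (LocCoh.of_injective N (d + 1) (congrArg Subtype.val h))
  have hcomp : weightSum N =
      (DFinsupp.lsum ℕ fun d => (V d).subtype).comp (DFinsupp.mapRange.linearMap ι) := by
    refine DirectSum.linearMap_ext ℂ fun d => LinearMap.ext fun w => ?_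
    rw [LinearMap.comp_apply, weightSum_lof]
    change _ = DFinsupp.lsum ℕ (fun d => (V d).subtype)
      (DFinsupp.mapRange (fun d => ι d) (fun d => map_zero _) (DFinsupp.single d w))
    rw [DFinsupp.mapRange_single, DFinsupp.lsum_single]
    rfl
  rw [hcomp]
  exact hV.dfinsupp_lsum_injective.comp
    ((DFinsupp.mapRange_injective (fun d => ι d) (fun d => map_zero _)).mpr hι)

/-- Local cohomology is the direct sum of the irreducible representations of highest weight
`(-1, …, -1, -i - 1)`. -/
def locCohEquiv (n : ℕ) :
    LocCoh (n + 1) (n + 1) ≃ₗ[ℂ] ⨁ i, schur (locCohWeight (n + 1) i) :=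
  (LinearEquiv.ofBijective (weightSum (n + 1))
    ⟨weightSum_injective (n + 1), weightSum_surjective (n + 1)⟩).symm ≪≫ₗ
      DFinsupp.mapRange.linearEquiv (weightEquiv n)

theorem locCohEquiv_of {n d : ℕ} (w : weightSpace (n + 1) d) :
    locCohEquiv n (LocCoh.of (n + 1) (n + 1) (d + 1) w.1) =
      DirectSum.lof ℂ ℕ (fun i => schur (locCohWeight (n + 1) i)) d (weightEquiv n d w) := by
  have h : (LinearEquiv.ofBijective (weightSum (n + 1))
      ⟨weightSum_injective (n + 1), weightSum_surjective (n + 1)⟩).symm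
        (LocCoh.of (n + 1) (n + 1) (d + 1) w.1) =
      DirectSum.lof ℂ ℕ (fun d => weightSpace (n + 1) d) d w := by
    rw [LinearEquiv.symm_apply_eq]
    exact (weightSum_lof w).symm
  rw [locCohEquiv, LinearEquiv.trans_apply, h]
  exact DFinsupp.mapRange_single (hf := fun i => map_zero (weightEquiv n i))

theorem locCoh_induction {N : ℕ} {p : LocCoh N N → Prop} (hadd : ∀ x y, p x → p y → p (x + y))
    (hmem : ∀ d, ∀ w : weightSpace N d, p (LocCoh.of N N (d + 1) w.1)) (x : LocCoh N N) : p x := by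
  obtain ⟨y, rfl⟩ := weightSum_surjective N x
  induction y using DirectSum.induction_on with
  | zero =>
    rw [map_zero]
    simpa using hmem 0 0
  | of d w =>
    have := hmem d w
    rwa [← weightSum_lof] at this
  | add y z hy hz => rw [map_add]; exact hadd _ _ hy hz

theorem locCohEquiv_locCohAct {n : ℕ} (g : GL (Fin (n + 1)) ℂ) (x : LocCoh (n + 1) (n + 1))
    (i : ℕ) : locCohEquiv n (locCohAct (n + 1) (n + 1) g x) i =
      schurRep (locCohWeight (n + 1) i) g (locCohEquiv n x i) := by
  induction x using locCoh_induction with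
  | hadd x y hx hy =>
    rw [map_add, map_add, DirectSum.add_apply, hx, hy, map_add, DirectSum.add_apply, map_add]
  | hmem d w =>
    have h1 := locCohEquiv_of ⟨_, extAct_mem_weightSpace g w.2⟩
    dsimp only at h1
    rw [locCohAct_of, h1, locCohEquiv_of]
    by_cases h : d = i
    · subst h
      rw [DirectSum.lof_apply, DirectSum.lof_apply]
      refine Subtype.ext (funext fun x => ?_)
      exact matrixCoeff_extAct g x w.1
    · rw [DirectSum.lof_eq_of, DirectSum.lof_eq_of, DirectSum.of_eq_of_ne _ _ _ (Ne.symm h),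
        DirectSum.of_eq_of_ne _ _ _ (Ne.symm h), map_zero]

theorem locCohEquiv_dilation {n : ℕ} (x : LocCoh (n + 1) (n + 1)) (i : ℕ) :
    locCohEquiv n (locCohAct (n + 1) (n + 1) (dilation (n + 1)) x) i =
      dilationEigenvalue (n + 1) i • locCohEquiv n x i := by
  induction x using locCoh_induction with
  | hadd x y hx hy =>
    rw [map_add, map_add, DirectSum.add_apply, hx, hy, map_add, DirectSum.add_apply, smul_add]
  | hmem d w =>
    rw [locCohAct_of, mem_weightSpace.mp w.2, map_smul, map_smul, DirectSum.smul_apply,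
      locCohEquiv_of]
    by_cases h : d = i
    · subst h
      rfl
    · rw [DirectSum.lof_eq_of, DirectSum.of_eq_of_ne _ _ _ (Ne.symm h), smul_zero, smul_zero]

/-! ### The grading of local cohomology -/

theorem locCohAct_dilation_of_mem_locCohPiece {N j : ℕ} {k : ℤ} {x : LocCoh N j}
    (hx : x ∈ locCohPiece N j k) : locCohAct N j (dilation N) x = (2 : ℂ) ^ k • x := by
  rw [← Module.End.mem_eigenspace_iff]
  refine Submodule.span_le.mpr ?_ hx
  rintro _ ⟨d, e, he, rfl⟩
  rw [SetLike.mem_coe, Module.End.mem_eigenspace_iff, locCohAct_of,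
    extAct_dilation_of_isHomogeneousExt he, map_smul]

theorem eq_of_mem_locCohPiece {n : ℕ} {k : ℤ} {x : LocCoh (n + 1) (n + 1)}
    (hx : x ∈ locCohPiece (n + 1) (n + 1) k) (i : ℕ) (hi : locCohEquiv n x i ≠ 0) :
    k = -(i : ℤ) - (n + 1 : ℕ) := by
  have h1 := locCohEquiv_dilation x i
  rw [locCohAct_dilation_of_mem_locCohPiece hx, map_smul, DirectSum.smul_apply] at h1
  exact two_zpow_injective (smul_left_injective ℂ hi h1)

theorem mem_iSup_locCohPiece {N j : ℕ} (x : LocCoh N j) : x ∈ ⨆ k, locCohPiece N j k := by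
  obtain ⟨d, e, rfl⟩ := x.exists_of
  have : Module.Finite (Poly N) (grQuot N d).carrier :=
    inferInstanceAs (Module.Finite (Poly N) (Poly N ⧸ maxIdeal N ^ d))
  have he := mem_closure_isHomogeneousExt (grSelf N) j (grQuot N d) e
  induction he using AddSubgroup.closure_induction with
  | mem e he =>
    obtain ⟨k, hk⟩ := he
    exact Submodule.mem_iSup_of_mem k (Submodule.subset_span ⟨d, e, hk, rfl⟩)
  | zero =>
    exact (map_zero (LocCoh.of N j d)).symm ▸ zero_mem _
  | add e f _ _ he hf =>
    exact (map_add (LocCoh.of N j d) e f).symm ▸ add_mem he hf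
  | neg e _ he =>
    exact (map_neg (LocCoh.of N j d) e).symm ▸ neg_mem he

theorem mem_locCohPiece_iff {n : ℕ} (k : ℤ) (x : LocCoh (n + 1) (n + 1)) :
    x ∈ locCohPiece (n + 1) (n + 1) k ↔
      ∀ i : ℕ, locCohEquiv n x i ≠ 0 → k = -(i : ℤ) - (n + 1 : ℕ) := by
  refine ⟨fun hx i hi => eq_of_mem_locCohPiece hx i hi, fun h => ?_⟩
  obtain ⟨f, hf, rfl⟩ := (Submodule.mem_iSup_iff_exists_finsupp _ _).mp (mem_iSup_locCohPiece x)
  -- By the forward direction, the components of `x` of degree different from `k` vanish.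
  have key : f.sum (fun _ y => y) = f k := by
    refine (locCohEquiv n).injective (DFinsupp.ext fun i => ?_)
    by_cases hi : k = -(i : ℤ) - (n + 1 : ℕ)
    · rw [Finsupp.sum, map_sum, DFinsupp.finsetSum_apply]
      refine Finset.sum_eq_single k (fun k' _ hk' => ?_) fun hk => ?_
      · exact by_contra fun h' => hk' ((eq_of_mem_locCohPiece (hf k') i h').trans hi.symm)
      · rw [Finsupp.notMem_support_iff.mp hk, map_zero]
        rfl
    · have h1 : locCohEquiv n (f.sum fun _ y => y) i = 0 := by_contra fun h' => hi (h i h')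
      have h2 : locCohEquiv n (f k) i = 0 :=
        by_contra fun h' => hi (eq_of_mem_locCohPiece (hf k) i h')
      exact h1.trans h2.symm
  rw [key]
  exact hf k

end GLN
end

theorem mainTheorem3 (N : ℕ) (hN : 1 ≤ N) :
    (∃ Φ : GLN.LocCoh N N ≃ₗ[ℂ] DirectSum ℕ fun i => GLN.schur (GLN.locCohWeight N i),
      (∀ (g : GL (Fin N) ℂ) (x : GLN.LocCoh N N) (i : ℕ),
        Φ (GLN.locCohAct N N g x) i = GLN.schurRep (GLN.locCohWeight N i) g (Φ x i)) ∧
      (∀ (k : ℤ) (x : GLN.LocCoh N N),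
        x ∈ GLN.locCohPiece N N k ↔ ∀ i : ℕ, Φ x i ≠ 0 → k = -(i : ℤ) - N)) ∧
    ∀ j : ℕ, j ≠ N → Subsingleton (GLN.LocCoh N j) := by
  obtain ⟨n, rfl⟩ := Nat.exists_eq_add_of_le' hN
  exact ⟨⟨GLN.locCohEquiv n, GLN.locCohEquiv_locCohAct, GLN.mem_locCohPiece_iff⟩,
    fun j hj => GLN.subsingleton_locCoh hj⟩
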